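/- Let $X$ and $H$ be real Hilbert spaces, $M=\{1,\dots,m\}$, and let $f,g_i\colon X\to\mathbb{R}$ ($i\in M$) and $F\colon X\to H$ be continuously Fréchet differentiable, $g=(g_1,\dots,g_m)$. Let $\phi\colon[0,\infty)\to[0,\infty]$ be convex, non-decreasing and lower semicontinuous, with $\phi(t)=0$ if and only if $t=0$, and with effective domain $\operatorname{dom}\phi\neq\{0\}$. Let $\psi\colon[0,\infty)^m\to\mathbb{R}$ be continuously differentiable and concave, with $\psi(0)>0$, with a global maximum at $0$, and with $\frac{\partial\psi}{\partial y_i}(y)=0$ whenever $y_i=0$. Maxima of vectors are coordinatewise, $|\cdot|$ is the Euclidean norm on $\mathbb{R}^m$, and $X\times H\times\mathbb{R}^m$ carries the sum of the inner products. Put $$b(x)=\psi(\max\{g(x),0\}),\qquad p(x,\mu)=\frac{b(x)}{1+|\mu|^2},\qquad \Omega=\{x\in X: b(x)>0,\ \phi(\|F(x)\|^2)<\infty\},$$ $$L(x,\lambda,\mu)=f(x)+\langle\lambda,F(x)\rangle+\langle\mu,g(x)\rangle,\qquad q(x,\mu,c)=\max\Big\{g(x),-\frac{p(x,\mu)}{c}\mu\Big\},$$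 $$\eta(x,\lambda,\mu)=\tfrac12\big\|DF(x)[\nabla_xL(x,\lambda,\mu)]\big\|^2+\tfrac12\sum_{i=1}^m\big(\langle\nabla g_i(x),\nabla_xL(x,\lambda,\mu)\rangle+g_i(x)^2\mu_i\big)^2 .$$ For $c>0$ the augmented Lagrangian is $$\mathscr{L}(x,\lambda,\mu,c)=f(x)+\langle\lambda,F(x)\rangle+\frac c2(1+\|\lambda\|^2)\phi(\|F(x)\|^2)+\langle\mu,q(x,\mu,c)\rangle+\frac{c}{2p(x,\mu)}|q(x,\mu,c)|^2+\eta(x,\lambda,\mu)$$ if $x\in\Omega$, and $\mathscr{L}(x,\lambda,\mu,c)=+\infty$ otherwise. For $\gamma\in\mathbb{R}$ and $r>0$ put $$S_c(\gamma)=\{(x,\lambda,\mu)\in X\times H\times\mathbb{R}^m:\mathscr{L}(x,\lambda,\mu,c)\le\gamma\},$$ $$\Omega_r(\gamma)=\{x\in\Omega: f(x)+r(\|F(x)\|^2+|\max\{g(x),0\}|^2)\le\gamma\}.$$ Finally, with $v=DF(x)^*[\lambda]+\sum_{i=1}^m\mu_i\nabla g_i(x)$, let $$Q(x)[\lambda,\mu]=\tfrac12\|DF(x)[v]\|^2+\tfrac12\sum_{i=1}^m\big(\langle\nabla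 g_i(x),v\rangle+g_i(x)^2\mu_i\big)^2 .$$ Assume that $f$, $F$ and all $g_i$ are twice continuously Fréchet differentiable on $\Omega$, that $\phi$ is continuously differentiable on its effective domain, and that $\phi'(0)>0$ (one-sided derivative). Call a set $V\subseteq\Omega$ admissible if it is bounded, if there is $a>0$ with $Q(x)[\lambda,\mu]\ge a(\|\lambda\|^2+|\mu|^2)$ for all $x\in V$, $\lambda\in H$, $\mu\in\mathbb{R}^m$, and if $f$, $F$, all $g_i$, and their first and second order Fréchet derivatives are bounded on $V$. 1. For every admissible $V$, every $K>0$ and $\gamma\in\mathbb{R}$, and every bounded set $\Lambda\subset H\times\mathbb{R}^m$ there is $c_*>0$ such that for all $c\ge c_*$ and all $(x,\lambda,\mu)\in(V\times\Lambda)\cap S_c(\gamma)$ the function $\mathscr{L}(\cdot,c)$ is Fréchet differentiable at $(x,\lambda,\mu)$ and its gradient in $(x,\lambda,\mu)$ satisfies $$\|\nabla\mathscr{L}(x,\lambda,\mu,c)\|\ \ge\ K\Big(\|F(x)\|+\Big|\max\Big\{g(x),-\frac{p(x,\mu)}{c}\mu\Big\}\Big|\Big).\qquad(*)$$ 2. If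 $V=\Omega_r(\gamma+\varepsilon)$ is admissible for some $r>0$, $\varepsilon>0$ and $\gamma\in\mathbb{R}$, then for every $K>0$ there is $c_*>0$ such that for all $c\ge c_*$ and all $(x,\lambda,\mu)\in S_c(\gamma)$ the function $\mathscr{L}(\cdot,c)$ is Fréchet differentiable at $(x,\lambda,\mu)$ and $(*)$ holds. -/

import Mathlib

open scoped NNReal ENNReal
open Set

noncomputable section

namespace ExactAL

/-- The Euclidean space `ℝ^m` of inequality multipliers. -/
abbrev Vec (m : ℕ) : Type := EuclideanSpace ℝ (Fin m)

/-- The data of the problem: minimise `f x` subject to `F x = 0` and `g i x ≤ 0` for all `i`,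
with continuously Fréchet differentiable `f`, `F`, `g i`. -/
structure Problem (X H : Type*) [NormedAddCommGroup X] [InnerProductSpace ℝ X]
    [NormedAddCommGroup H] [InnerProductSpace ℝ H] (m : ℕ) where
  /-- objective -/
  f : X → ℝ
  /-- equality constraint -/
  F : X → H
  /-- inequality constraints -/
  g : Fin m → X → ℝ
  contDiff_f : ContDiff ℝ 1 f
  contDiff_F : ContDiff ℝ 1 F
  contDiff_g : ∀ i, ContDiff ℝ 1 (g i)

/-- A convex, non-decreasing, lower semicontinuous function `φ : [0, ∞) → [0, ∞]` that vanishes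
exactly at `0` and whose effective domain is not `{0}`. -/
structure PenaltyFunction where
  /-- the function itself -/
  toFun : ℝ≥0 → ℝ≥0∞
  convex : ConvexOn ℝ≥0 univ toFun
  mono : Monotone toFun
  lsc : LowerSemicontinuous toFun
  eq_zero_iff : ∀ t, toFun t = 0 ↔ t = 0
  dom_ne : {t | toFun t < ⊤} ≠ {0}

namespace PenaltyFunction

/-- The effective domain of `φ`, as a subset of the real line. -/
def dom (φ : PenaltyFunction) : Set ℝ := {t | 0 ≤ t ∧ φ.toFun t.toNNReal < ⊤}

/-- `φ` as a real-valued function (meaningful on its effective domain). -/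
def real (φ : PenaltyFunction) (t : ℝ) : ℝ := (φ.toFun t.toNNReal).toReal

/-- `φ` is continuously differentiable on its effective domain (one-sidedly at `0`). -/
def IsC1 (φ : PenaltyFunction) : Prop := ContDiffOn ℝ 1 φ.real φ.dom

/-- The (one-sided) derivative of `φ` at `0`. -/
def derivZero (φ : PenaltyFunction) : ℝ := derivWithin φ.real φ.dom 0

end PenaltyFunction

/-- The nonnegative orthant `[0, ∞)^m`. -/
def orthant (m : ℕ) : Set (Vec m) := {y | ∀ i, 0 ≤ y i}

/-- A continuously differentiable concave function `ψ : [0, ∞)^m → ℝ` with `ψ 0 > 0`, with a global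
maximum at `0`, and with `∂ψ/∂y_i = 0` wherever `y_i = 0`. Values off the orthant are irrelevant. -/
structure WeightFunction (m : ℕ) where
  /-- the function itself -/
  toFun : Vec m → ℝ
  contDiffOn : ContDiffOn ℝ 1 toFun (orthant m)
  concave : ConcaveOn ℝ (orthant m) toFun
  pos : 0 < toFun 0
  le_zero : ∀ y ∈ orthant m, toFun y ≤ toFun 0
  partial_eq_zero : ∀ y ∈ orthant m, ∀ i, y i = 0 →
    fderivWithin ℝ toFun (orthant m) y (EuclideanSpace.single i 1) = 0

/-- Coordinatewise maximum of two vectors. -/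
def vmax {m : ℕ} (y z : Vec m) : Vec m := WithLp.toLp 2 fun i => max (y i) (z i)

namespace Problem

variable {X H : Type*} [NormedAddCommGroup X] [InnerProductSpace ℝ X] [CompleteSpace X]
  [NormedAddCommGroup H] [InnerProductSpace ℝ H] [CompleteSpace H] {m : ℕ}

/-- The vector `g(x) = (g_1(x), …, g_m(x))`. -/
def gvec (P : Problem X H m) (x : X) : Vec m := WithLp.toLp 2 fun i => P.g i x

/-- The vector `∇g(x) y` with coordinates `⟨∇g_i(x), y⟩`. -/
def gradg (P : Problem X H m) (x y : X) : Vec m :=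
  WithLp.toLp 2 fun i => inner ℝ (gradient (P.g i) x) y

/-- The vector `diag(g_i(x)^2) μ`. -/
def diagSq (P : Problem X H m) (x : X) (mu : Vec m) : Vec m :=
  WithLp.toLp 2 fun i => P.g i x ^ 2 * mu i

/-- The classical Lagrangian `L(x, λ, μ)`. -/
def lagrangian (P : Problem X H m) (x : X) (lam : H) (mu : Vec m) : ℝ :=
  P.f x + inner ℝ lam (P.F x) + inner ℝ mu (P.gvec x)

/-- `∇_x L(x, λ, μ)`. -/
def gradLagrangian (P : Problem X H m) (x : X) (lam : H) (mu : Vec m) : X :=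
  gradient (fun y => P.lagrangian y lam mu) x

/-- `b(x) = ψ(max{g(x), 0})`. -/
def b (P : Problem X H m) (ψ : WeightFunction m) (x : X) : ℝ := ψ.toFun (vmax (P.gvec x) 0)

/-- `p(x, μ) = b(x) / (1 + |μ|^2)`. -/
def p (P : Problem X H m) (ψ : WeightFunction m) (x : X) (mu : Vec m) : ℝ :=
  P.b ψ x / (1 + ‖mu‖ ^ 2)

/-- `Ω = {x | b(x) > 0, φ(‖F(x)‖^2) < ∞}`. -/
def Omega (P : Problem X H m) (φ : PenaltyFunction) (ψ : WeightFunction m) : Set X :=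
  {x | 0 < P.b ψ x ∧ φ.toFun (‖P.F x‖₊ ^ 2) < ⊤}

/-- `max{g(x), -p(x, μ) μ / c}`. -/
def q (P : Problem X H m) (ψ : WeightFunction m) (x : X) (mu : Vec m) (c : ℝ) : Vec m :=
  vmax (P.gvec x) (-(P.p ψ x mu / c) • mu)

/-- The term `η(x, λ, μ)` penalising the violation of the KKT conditions. -/
def eta (P : Problem X H m) (x : X) (lam : H) (mu : Vec m) : ℝ :=
  1 / 2 * ‖fderiv ℝ P.F x (P.gradLagrangian x lam mu)‖ ^ 2
    + 1 / 2 * ‖P.gradg x (P.gradLagrangian x lam mu) + P.diagSq x mu‖ ^ 2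

open Classical in
/-- The augmented Lagrangian, with the value `+∞` for `x` outside `Ω`. -/
def augLag (P : Problem X H m) (φ : PenaltyFunction) (ψ : WeightFunction m)
    (x : X) (lam : H) (mu : Vec m) (c : ℝ) : EReal :=
  if x ∈ P.Omega φ ψ then
    ((P.f x + inner ℝ lam (P.F x)
      + c / 2 * (1 + ‖lam‖ ^ 2) * (φ.toFun (‖P.F x‖₊ ^ 2)).toReal
      + inner ℝ mu (P.q ψ x mu c)
      + c / (2 * P.p ψ x mu) * ‖P.q ψ x mu c‖ ^ 2
      + P.eta x lam mu : ℝ) : EReal)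
  else ⊤

/-- The sublevel set `S_c(γ)` of the augmented Lagrangian. -/
def sublevel (P : Problem X H m) (φ : PenaltyFunction) (ψ : WeightFunction m) (c γ : ℝ) :
    Set (X × H × Vec m) :=
  {z | P.augLag φ ψ z.1 z.2.1 z.2.2 c ≤ (γ : EReal)}

/-- The Hilbert product `X × H × ℝ^m`, with the sum of the inner products. -/
abbrev _root_.ExactAL.Prod3 (X H : Type*) (m : ℕ) : Type _ :=
  WithLp 2 (X × WithLp 2 (H × Vec m))

/-- The point `(x, λ, μ)` of the Hilbert product. -/
def _root_.ExactAL.mk3 {X H : Type*} {m : ℕ} (x : X) (lam : H) (mu : Vec m) : Prod3 X H m :=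
  WithLp.toLp 2 (x, WithLp.toLp 2 (lam, mu))

/-- The function `(x, λ, μ) ↦ 𝓛(x, λ, μ, c)` on the Hilbert product, real-valued so that it can be
differentiated (it is used at interior points of the effective domain). -/
def augLagReal (P : Problem X H m) (φ : PenaltyFunction) (ψ : WeightFunction m) (c : ℝ)
    (z : Prod3 X H m) : ℝ :=
  (P.augLag φ ψ z.fst z.snd.fst z.snd.snd c).toReal

/-- The quadratic form `Q(x)[λ, μ]`. -/
def Q (P : Problem X H m) (x : X) (lam : H) (mu : Vec m) : ℝ :=
  1 / 2 * ‖fderiv ℝ P.F x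
      (ContinuousLinearMap.adjoint (fderiv ℝ P.F x) lam + ∑ i, mu i • gradient (P.g i) x)‖ ^ 2
    + 1 / 2 * ‖P.gradg x
      (ContinuousLinearMap.adjoint (fderiv ℝ P.F x) lam + ∑ i, mu i • gradient (P.g i) x)
        + P.diagSq x mu‖ ^ 2

/-- `Q(x)[·]` is uniformly positive definite on `V`. -/
def UniformlyPosDef (P : Problem X H m) (V : Set X) : Prop :=
  ∃ a > 0, ∀ x ∈ V, ∀ (lam : H) (mu : Vec m), a * (‖lam‖ ^ 2 + ‖mu‖ ^ 2) ≤ P.Q x lam mu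

/-- `Ω_r(γ) = {x ∈ Ω | f(x) + r (‖F(x)‖^2 + |max{g(x), 0}|^2) ≤ γ}`. -/
def penaltySublevel (P : Problem X H m) (φ : PenaltyFunction) (ψ : WeightFunction m) (r γ : ℝ) :
    Set X :=
  {x | x ∈ P.Omega φ ψ ∧ P.f x + r * (‖P.F x‖ ^ 2 + ‖vmax (P.gvec x) 0‖ ^ 2) ≤ γ}

/-- `‖F(x)‖ + |max{g(x), -p(x, μ) μ / c}|`. -/
def infeas (P : Problem X H m) (ψ : WeightFunction m) (x : X) (mu : Vec m) (c : ℝ) : ℝ :=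
  ‖P.F x‖ + ‖P.q ψ x mu c‖

/-- `u` and its first and second Fréchet derivatives are bounded on `V`. -/
def _root_.ExactAL.BoundedC2On {X Y : Type*} [NormedAddCommGroup X] [NormedSpace ℝ X]
    [NormedAddCommGroup Y] [NormedSpace ℝ Y] (u : X → Y) (V : Set X) : Prop :=
  ∃ B : ℝ, ∀ x ∈ V, ‖u x‖ ≤ B ∧ ‖fderiv ℝ u x‖ ≤ B ∧ ‖fderiv ℝ (fderiv ℝ u) x‖ ≤ B

/-- The assumptions on the set `V`: it is a bounded subset of `Ω`, `Q` is uniformly positive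
definite on it, and `f`, `F`, `g_i` are bounded on it with their first two derivatives. -/
def Admissible (P : Problem X H m) (φ : PenaltyFunction) (ψ : WeightFunction m) (V : Set X) :
    Prop :=
  V ⊆ P.Omega φ ψ ∧ Bornology.IsBounded V ∧ P.UniformlyPosDef V ∧
    BoundedC2On P.f V ∧ BoundedC2On P.F V ∧ ∀ i, BoundedC2On (P.g i) V

/-- The gradient of `𝓛(·, c)` exists at `(x, λ, μ)`, and its norm is at least `K` times the
infeasibility measure. -/
def GradEstimate (P : Problem X H m) (φ : PenaltyFunction) (ψ : WeightFunction m) (K c : ℝ)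
    (x : X) (lam : H) (mu : Vec m) : Prop :=
  DifferentiableAt ℝ (P.augLagReal φ ψ c) (mk3 x lam mu) ∧
    K * P.infeas ψ x mu c ≤ ‖gradient (P.augLagReal φ ψ c) (mk3 x lam mu)‖

end Problem

end ExactAL

end

/-! Put `A y = (DF(x)[y], ∇g(x) y)` and `N = A A* + diag(0, g(x)²)`, where `A*` is `adjMap`. Then
`Q(x)[λ, μ] = ½‖N(λ, μ)‖²`, so uniform positive definiteness bounds the self-adjoint operator `N`
from below on `V`. Since `∇_x L = ∇f + A*(λ, μ)`, the residual `r = (resF, resG)` equals `A ∇f +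
N(λ, μ)`, and `η = ½‖r‖²`.

Let `S` be the sum of `‖∇𝓛‖`, `‖F‖`, `|q|`, `c‖F‖²` and `c|q|²`. The lower bound for `N` is used
twice. The `(λ, μ)`-part of `∇𝓛` is `N r + (F, q)` plus terms of order `c‖F‖² + c|q|²`, hence `‖r‖ =
O(S)`. The `x`-part is `w = ∇_x L + A* z` up to `O(c|q|²)` and `O(‖r‖)`, where `z₁ = c (1 + ‖λ‖²)
φ'(‖F‖²) F` and `z₂ = (c/p) q`; hence `‖w‖ = O(S)`. Now `N z = A w - r + diag(g²)(μ + z₂)` up to the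
zero first component of the last term, which is `O(c|q|²)` by complementarity. So `‖z‖ = O(S)`,
whereas `‖z‖` is at least a constant times `c (‖F‖ + |q|)`. This is `exists_gradient_estimate`,
resting on the gradient formula `hasFDerivAt_augLagReal`.

On a sublevel set `c‖F‖²` and `c|q|²` stay bounded (`le_of_mem_sublevel`), so `‖F‖` and `|q|` are
small for large `c` (`exists_infeas_le`). The quadratic part of `S` is then absorbed, leaving `‖∇𝓛‖
≥ const · c (‖F‖ + |q|)`, which beats any `K`. Near feasibility also keeps `x` inside `Ω` and `b`
away from zero.

For the second claim, the sublevel set lies over `Ω_r(γ + ε)` and `η` is bounded on it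
(`exists_sublevel_subset`). Because `N(λ, μ) = r - A ∇f`, this bounds the multipliers
(`norm_add_le_of_eta_le`) and reduces the claim to the first one. -/

noncomputable section

set_option linter.unusedSectionVars false

namespace ExactAL

/-! ### The penalty `φ` as a convex real function -/

namespace PenaltyFunction

variable (φ : PenaltyFunction)

theorem toFun_zero : φ.toFun 0 = 0 := (φ.eq_zero_iff 0).2 rfl

theorem zero_mem_dom : (0 : ℝ) ∈ φ.dom := ⟨le_rfl, by simp [φ.toFun_zero]⟩

theorem real_zero : φ.real 0 = 0 := by simp [real, φ.toFun_zero]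

theorem real_nonneg (t : ℝ) : 0 ≤ φ.real t := ENNReal.toReal_nonneg

theorem mem_dom_of_le {s t : ℝ} (ht : t ∈ φ.dom) (hs : 0 ≤ s) (hst : s ≤ t) : s ∈ φ.dom :=
  ⟨hs, (φ.mono (Real.toNNReal_le_toNNReal hst)).trans_lt ht.2⟩

theorem exists_pos_mem_dom : ∃ t > 0, t ∈ φ.dom := by
  by_contra! h
  refine φ.dom_ne (Set.eq_singleton_iff_unique_mem.2 ⟨by simp [φ.toFun_zero], fun t ht => ?_⟩)
  by_contra h0
  exact h t (NNReal.coe_pos.2 (pos_iff_ne_zero.2 h0)) ⟨t.2, by simpa using ht⟩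

/-- On the effective domain both sides of the extended-valued convexity inequality are finite, so it
survives `toReal`. -/
theorem convexOn_real : ConvexOn ℝ φ.dom φ.real := by
  have key : ∀ x ∈ φ.dom, ∀ y ∈ φ.dom, ∀ a b : ℝ, 0 ≤ a → 0 ≤ b → a + b = 1 →
      φ.toFun (a * x + b * y).toNNReal ≤
        a.toNNReal * φ.toFun x.toNNReal + b.toNNReal * φ.toFun y.toNNReal := by
    intro x hx y hy a b ha hb hab
    have := φ.convex.2 (mem_univ x.toNNReal) (mem_univ y.toNNReal) zero_le
      zero_le (by rw [← Real.toNNReal_add ha hb, hab, Real.toNNReal_one])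
    rw [Real.toNNReal_add (mul_nonneg ha hx.1) (mul_nonneg hb hy.1), Real.toNNReal_mul ha,
      Real.toNNReal_mul hb]
    simpa [ENNReal.smul_def] using this
  have fin : ∀ x ∈ φ.dom, ∀ y ∈ φ.dom, ∀ a b : ℝ,
      (a.toNNReal * φ.toFun x.toNNReal + b.toNNReal * φ.toFun y.toNNReal : ℝ≥0∞) < ⊤ :=
    fun x hx y hy a b => ENNReal.add_lt_top.2
      ⟨ENNReal.mul_lt_top ENNReal.coe_lt_top hx.2, ENNReal.mul_lt_top ENNReal.coe_lt_top hy.2⟩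
  refine ⟨fun x hx y hy a b ha hb hab => ?_, fun x hx y hy a b ha hb hab => ?_⟩
  · exact ⟨add_nonneg (mul_nonneg ha hx.1) (mul_nonneg hb hy.1),
      (key x hx y hy a b ha hb hab).trans_lt (fin x hx y hy a b)⟩
  · have := ENNReal.toReal_mono (fin x hx y hy a b).ne (key x hx y hy a b ha hb hab)
    rw [ENNReal.toReal_add (ENNReal.mul_lt_top ENNReal.coe_lt_top hx.2).ne
      (ENNReal.mul_lt_top ENNReal.coe_lt_top hy.2).ne, ENNReal.toReal_mul,
      ENNReal.toReal_mul] at this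
    simpa [real, ha, hb] using this

/-- A convex function vanishing at `0` lies below its chords from the origin. -/
theorem exists_real_le_mul :
    ∃ T > 0, T ∈ φ.dom ∧ ∃ C ≥ 0, ∀ t, 0 ≤ t → t ≤ T → φ.real t ≤ C * t := by
  obtain ⟨T, hT, hTd⟩ := φ.exists_pos_mem_dom
  refine ⟨T, hT, hTd, φ.real T / T, div_nonneg (φ.real_nonneg T) hT.le, fun t h0 ht => ?_⟩
  have h := φ.convexOn_real.2 hTd φ.zero_mem_dom (div_nonneg h0 hT.le)
    (sub_nonneg.2 ((div_le_one hT).2 ht)) (by ring)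
  simp only [smul_eq_mul, mul_zero, add_zero, φ.real_zero, div_mul_cancel₀ t hT.ne'] at h
  calc φ.real t ≤ t / T * φ.real T := h
    _ = φ.real T / T * t := by ring

variable {φ}

theorem IsC1.hasDerivWithinAt (hφ : φ.IsC1) {t : ℝ} (ht : t ∈ φ.dom) :
    HasDerivWithinAt φ.real (derivWithin φ.real φ.dom t) φ.dom t :=
  ((hφ.differentiableOn one_ne_zero) t ht).hasDerivWithinAt

/-- By convexity the graph lies above its tangent at `0`. This makes the penalty dominate a
quadratic in `‖F‖`. -/
theorem IsC1.derivZero_mul_le (hφ : φ.IsC1) {t : ℝ} (ht : t ∈ φ.dom) :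
    φ.derivZero * t ≤ φ.real t := by
  rcases ht.1.eq_or_lt with rfl | h0
  · simp [φ.real_zero]
  · have := φ.convexOn_real.derivWithin_le_slope φ.zero_mem_dom ht h0
      ((hφ.differentiableOn one_ne_zero) 0 φ.zero_mem_dom)
    rw [slope_def_field, φ.real_zero, sub_zero, sub_zero, le_div_iff₀ h0] at this
    exact this

theorem IsC1.derivZero_le (hφ : φ.IsC1) {t : ℝ} (ht : t ∈ φ.dom) :
    φ.derivZero ≤ derivWithin φ.real φ.dom t :=
  φ.convexOn_real.monotoneOn_derivWithin (hφ.differentiableOn one_ne_zero) φ.zero_mem_dom ht ht.1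

end PenaltyFunction

theorem toFun_nnnorm_sq {H : Type*} [NormedAddCommGroup H] (φ : PenaltyFunction) (y : H) :
    φ.toFun (‖y‖₊ ^ 2) = φ.toFun (‖y‖ ^ 2).toNNReal := by
  congr 1
  rw [Real.toNNReal_pow (norm_nonneg y), norm_toNNReal]

theorem toFun_nnnorm_sq_lt_top_iff {H : Type*} [NormedAddCommGroup H] {φ : PenaltyFunction}
    {y : H} : φ.toFun (‖y‖₊ ^ 2) < ⊤ ↔ ‖y‖ ^ 2 ∈ φ.dom := by
  rw [toFun_nnnorm_sq]
  exact ⟨fun h => ⟨sq_nonneg _, h⟩, fun h => h.2⟩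

/-! ### The scalar term of one inequality constraint -/

/-- The contribution `μ q + c / (2 p) q ^ 2`, `q = max {g, -p μ / c}`, of one inequality. -/
def ineqTerm (c g p mu : ℝ) : ℝ :=
  mu * max g (-(p / c) * mu) + c / (2 * p) * max g (-(p / c) * mu) ^ 2

/-- Completing the square moves the maximum inside `max (·) 0 ^ 2`, which is differentiable although
the maximum is not. -/
theorem ineqTerm_eq {c p : ℝ} (hc : 0 < c) (hp : 0 < p) (g mu : ℝ) :
    ineqTerm c g p mu = c / (2 * p) * max (g + p / c * mu) 0 ^ 2 - p * mu ^ 2 / (2 * c) := by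
  have : max (g + p / c * mu) 0 = max g (-(p / c) * mu) + p / c * mu := by
    rw [max_add]
    ring_nf
  rw [this, ineqTerm]
  field_simp
  ring

theorem hasDerivAt_max_zero_sq (s : ℝ) :
    HasDerivAt (fun t : ℝ => max t 0 ^ 2) (2 * max s 0) s := by
  rcases lt_trichotomy s 0 with h | rfl | h
  · rw [max_eq_right h.le, mul_zero]
    refine (hasDerivAt_const s (0 : ℝ)).congr_of_eventuallyEq ?_
    filter_upwards [Iio_mem_nhds h] with t ht
    simp [max_eq_right ((mem_Iio.1 ht).le)]
  · rw [max_self, mul_zero, hasDerivAt_iff_isLittleO]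
    have h2 : (fun t : ℝ => t ^ 2) =o[nhds 0] fun t => t := by
      simpa using Asymptotics.isLittleO_pow_id (𝕜 := ℝ) (n := 2) one_lt_two
    refine (Asymptotics.IsBigO.of_bound 1 ?_).trans_isLittleO (by simpa using h2)
    filter_upwards with t
    have : max t 0 ^ 2 ≤ t ^ 2 := by
      rcases le_total t 0 with h | h <;> simp [h, sq_nonneg]
    simpa [abs_of_nonneg, sq_nonneg] using this
  · rw [max_eq_left h.le]
    refine (by simpa using hasDerivAt_pow 2 s : HasDerivAt (fun t : ℝ => t ^ 2) (2 * s) s)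
      |>.congr_of_eventuallyEq ?_
    filter_upwards [Ioi_mem_nhds h] with t ht
    simp [max_eq_left ((mem_Ioi.1 ht).le)]

/-- Chain rule for `ineqTerm`. -/
theorem HasFDerivAt.ineqTerm {E : Type*} [NormedAddCommGroup E] [NormedSpace ℝ E] {c : ℝ}
    (hc : 0 < c) {g p mu : E → ℝ} {g' p' mu' : E →L[ℝ] ℝ} {z : E} (hg : HasFDerivAt g g' z)
    (hp : HasFDerivAt p p' z) (hmu : HasFDerivAt mu mu' z) (hpos : 0 < p z) {q : ℝ}
    (hq : q = max (g z) (-(p z / c) * mu z)) :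
    HasFDerivAt (fun y => ineqTerm c (g y) (p y) (mu y))
      ((mu z + c / p z * q) • g' + q • mu' - (c / (2 * p z ^ 2) * q ^ 2) • p') z := by
  have hw : max (g z + p z / c * mu z) 0 = q + p z / c * mu z := by
    rw [hq, max_add]
    ring_nf
  have h1 : HasFDerivAt (fun y => g y + p y * c⁻¹ * mu y) _ z :=
    hg.add ((hp.mul_const c⁻¹).mul hmu)
  have h2 := (hasDerivAt_max_zero_sq (g z + p z * c⁻¹ * mu z)).comp_hasFDerivAt z h1
  have h3 := ((hasDerivAt_inv hpos.ne').comp_hasFDerivAt z hp).const_mul (c / 2)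
  have h4 := (hp.mul (hmu.pow 2)).mul_const (1 / (2 * c))
  refine (((h3.mul h2).sub h4).congr_of_eventuallyEq ?_).congr_fderiv ?_
  · filter_upwards [hp.continuousAt.eventually (lt_mem_nhds hpos)] with y hy
    rw [ineqTerm_eq hc hy]
    simp only [Function.comp_apply, Pi.mul_apply, Pi.sub_apply]
    field_simp
  · have hw' : max (g z + p z * c⁻¹ * mu z) 0 = q + p z / c * mu z := by
      rw [← hw, div_eq_mul_inv]
    ext y
    simp only [Function.comp_apply, hw', add_apply,
      sub_apply, smul_apply, smul_eq_mul]
    field_simp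
    ring

/-- The difference of the two sides is the square `c / (4 p) (q + 2 p μ / c)²`: half of the
quadratic term is spent on absorbing `μ q`. -/
theorem neg_le_ineqTerm {c p : ℝ} (hc : 0 < c) (hp : 0 < p) (g mu : ℝ) :
    c / (4 * p) * max g (-(p / c) * mu) ^ 2 - p * mu ^ 2 / c ≤ ineqTerm c g p mu := by
  have : 0 ≤ c / (4 * p) * (max g (-(p / c) * mu) + 2 * p / c * mu) ^ 2 := by positivity
  have e : ineqTerm c g p mu - (c / (4 * p) * max g (-(p / c) * mu) ^ 2 - p * mu ^ 2 / c)
      = c / (4 * p) * (max g (-(p / c) * mu) + 2 * p / c * mu) ^ 2 := by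
    rw [ineqTerm]
    field_simp
    ring
  linarith

/-! ### Coordinates and the orthant in `ℝ^m` -/

theorem norm_le_sum_abs {m : ℕ} (y : Vec m) : ‖y‖ ≤ ∑ i, |y i| := by
  conv_lhs => rw [← (EuclideanSpace.basisFun (Fin m) ℝ).sum_repr y]
  refine (norm_sum_le _ _).trans (Finset.sum_le_sum fun i _ => ?_)
  simp [norm_smul]

theorem abs_coord_le_norm {m : ℕ} (y : Vec m) (i : Fin m) : |y i| ≤ ‖y‖ :=
  PiLp.norm_apply_le y i

theorem norm_le_norm_of_abs_le {m : ℕ} {y z : Vec m} (h : ∀ i, |y i| ≤ |z i|) : ‖y‖ ≤ ‖z‖ := by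
  rw [EuclideanSpace.norm_eq, EuclideanSpace.norm_eq]
  exact Real.sqrt_le_sqrt (Finset.sum_le_sum fun i _ => pow_le_pow_left₀ (norm_nonneg _) (h i) 2)

theorem norm_vmax_sub_le {m : ℕ} (y z : Vec m) : ‖vmax y 0 - vmax z 0‖ ≤ ‖y - z‖ :=
  norm_le_norm_of_abs_le fun i => abs_max_sub_max_le_abs (y i) (z i) 0

theorem vmax_zero_mem_orthant {m : ℕ} (y : Vec m) : vmax y 0 ∈ orthant m :=
  fun _ => le_max_right _ _

theorem norm_vmax_zero_le {m : ℕ} (y : Vec m) : ‖vmax y 0‖ ≤ ‖y‖ :=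
  norm_le_norm_of_abs_le fun i => abs_max_le_max_abs_abs.trans (by simp)

theorem isClosed_orthant (m : ℕ) : IsClosed (orthant m) := by
  rw [orthant, ofPred_forall]
  exact isClosed_iInter fun i => isClosed_le continuous_const (by fun_prop)

theorem convex_orthant (m : ℕ) : Convex ℝ (orthant m) :=
  fun _ hy _ hz _ _ ha hb _ i => add_nonneg (mul_nonneg ha (hy i)) (mul_nonneg hb (hz i))

theorem uniqueDiffOn_orthant (m : ℕ) : UniqueDiffOn ℝ (orthant m) := by
  refine uniqueDiffOn_convex (convex_orthant m)
    ⟨WithLp.toLp 2 fun _ => 1, mem_interior.2 ⟨{y | ∀ i, 0 < y i}, fun y hy i => (hy i).le, ?_, ?_⟩⟩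
  · rw [ofPred_forall]
    exact isOpen_iInter_of_finite fun i => isOpen_lt continuous_const (by fun_prop)
  · intro i
    simp

/-! ### The weight `ψ` and the differentiability of `b` -/

namespace WeightFunction

variable {m : ℕ} (ψ : WeightFunction m)

/-- Keeps `b` away from zero, and hence `1 / p` bounded for bounded `μ`, at nearly feasible points.
-/
theorem exists_half_le :
    ∃ δ > 0, ∀ y ∈ orthant m, ‖y‖ ≤ δ → ψ.toFun 0 / 2 ≤ ψ.toFun y := by
  have h := ψ.contDiffOn.continuousOn 0 (fun i => le_rfl)
  obtain ⟨δ, hδ, h⟩ := Metric.continuousWithinAt_iff.1 h _ (half_pos ψ.pos)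
  refine ⟨δ / 2, half_pos hδ, fun y hy hn => ?_⟩
  have := h hy (by rw [dist_zero_right]; linarith)
  rw [Real.dist_eq, abs_lt] at this
  linarith

theorem exists_norm_fderivWithin_le (R : ℝ) :
    ∃ C ≥ 0, ∀ y ∈ orthant m, ‖y‖ ≤ R → ‖fderivWithin ℝ ψ.toFun (orthant m) y‖ ≤ C := by
  have hK : IsCompact (Metric.closedBall 0 R ∩ orthant m) :=
    (isCompact_closedBall _ _).inter_right (isClosed_orthant m)
  obtain ⟨C, hC⟩ := hK.exists_bound_of_continuousOn
    ((ψ.contDiffOn.continuousOn_fderivWithin (uniqueDiffOn_orthant m) le_rfl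
      |>.mono inter_subset_right))
  exact ⟨max C 0, le_max_right _ _, fun y hy hn =>
    (hC y ⟨by simpa using hn, hy⟩).trans (le_max_left _ _)⟩

end WeightFunction

namespace Problem

variable {X H : Type*} [NormedAddCommGroup X] [InnerProductSpace ℝ X] [CompleteSpace X]
  [NormedAddCommGroup H] [InnerProductSpace ℝ H] [CompleteSpace H] {m : ℕ}
  (P : Problem X H m) (ψ : WeightFunction m)

theorem hasFDerivAt_f (x : X) : HasFDerivAt P.f (fderiv ℝ P.f x) x :=
  (P.contDiff_f.differentiable one_ne_zero x).hasFDerivAt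

theorem hasFDerivAt_F (x : X) : HasFDerivAt P.F (fderiv ℝ P.F x) x :=
  (P.contDiff_F.differentiable one_ne_zero x).hasFDerivAt

theorem hasFDerivAt_g (i : Fin m) (x : X) : HasFDerivAt (P.g i) (fderiv ℝ (P.g i) x) x :=
  ((P.contDiff_g i).differentiable one_ne_zero x).hasFDerivAt

theorem differentiable_gvec : Differentiable ℝ P.gvec := fun x =>
  (differentiableAt_euclidean).2 fun i => (P.hasFDerivAt_g i x).differentiableAt

/-- The derivative of `b`. -/
def bDeriv (x : X) : X →L[ℝ] ℝ :=
  ∑ i, fderivWithin ℝ ψ.toFun (orthant m) (vmax (P.gvec x) 0) (EuclideanSpace.single i 1) •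
    fderiv ℝ (P.g i) x

theorem b_le (x : X) : P.b ψ x ≤ ψ.toFun 0 := ψ.le_zero _ (vmax_zero_mem_orthant _)

/-- The coefficients are frozen at `x`. Where `g i x ≤ 0` the coefficient vanishes by the condition
on `∂ψ/∂y_i`, so the kink of the maximum is invisible; where `g i x > 0` the maximum is locally `g
i`. -/
theorem hasFDerivAt_sum_max (x : X) : HasFDerivAt (fun y => ∑ i,
    fderivWithin ℝ ψ.toFun (orthant m) (vmax (P.gvec x) 0) (EuclideanSpace.single i 1) *
      max (P.g i y) 0) (P.bDeriv ψ x) x := by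
  refine HasFDerivAt.fun_sum fun i _ => ?_
  rcases le_or_gt (P.g i x) 0 with h | h
  · rw [ψ.partial_eq_zero _ (vmax_zero_mem_orthant _) i (max_eq_right h)]
    simpa using hasFDerivAt_const (0 : ℝ) x
  · refine HasFDerivAt.const_mul ((P.hasFDerivAt_g i x).congr_of_eventuallyEq ?_) _
    filter_upwards [(P.hasFDerivAt_g i x).continuousAt.eventually (lt_mem_nhds h)] with y hy
    exact max_eq_left hy.le

/-- The map `max{g, 0}` is not differentiable, but its increment is `O(y - x)`. The remainder of `ψ`
within the orthant is therefore `o(y - x)`, and the linear part of `ψ` along this map is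
differentiable by `hasFDerivAt_sum_max`. -/
theorem hasFDerivAt_b (x : X) : HasFDerivAt (P.b ψ) (P.bDeriv ψ x) x := by
  set Y : X → Vec m := fun y => vmax (P.gvec y) 0 with hY
  set D := fderivWithin ℝ ψ.toFun (orthant m) (Y x) with hD
  have hO : (fun y => Y y - Y x) =O[nhds x] fun y => y - x :=
    (Asymptotics.IsBigO.of_bound 1 (Filter.Eventually.of_forall fun y => by
      simpa using norm_vmax_sub_le (P.gvec y) (P.gvec x))).trans
      (P.differentiable_gvec x).isBigO_sub
  have hYc : Filter.Tendsto Y (nhds x) (nhdsWithin (Y x) (orthant m)) := by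
    refine tendsto_nhdsWithin_iff.2 ⟨?_, Filter.Eventually.of_forall fun y =>
      vmax_zero_mem_orthant _⟩
    refine tendsto_sub_nhds_zero_iff.1 (hO.trans_tendsto ?_)
    exact tendsto_sub_nhds_zero_iff.2 Filter.tendsto_id
  have h1 : HasFDerivWithinAt ψ.toFun D (orthant m) (Y x) :=
    (ψ.contDiffOn.differentiableOn one_ne_zero _ (vmax_zero_mem_orthant _)).hasFDerivWithinAt
  have h2 := (h1.isLittleO.comp_tendsto hYc).trans_isBigO hO
  have h3 := (P.hasFDerivAt_sum_max ψ x).isLittleO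
  refine HasFDerivAt.of_isLittleO ((h2.add h3).congr_left fun y => ?_)
  have e : D (Y y - Y x) = ∑ i, D (EuclideanSpace.single i 1) * max (P.g i y) 0 -
      ∑ i, D (EuclideanSpace.single i 1) * max (P.g i x) 0 := by
    conv_lhs => rw [← (EuclideanSpace.basisFun (Fin m) ℝ).sum_repr (Y y - Y x)]
    rw [map_sum, ← Finset.sum_sub_distrib]
    refine Finset.sum_congr rfl fun i _ => ?_
    simp only [EuclideanSpace.basisFun_repr, EuclideanSpace.basisFun_apply, map_smul, smul_eq_mul]
    rw [← mul_sub, mul_comm]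
    rfl
  simp only [Function.comp_apply, e]
  simp only [b, Y]
  ring

theorem norm_bDeriv_le {x : X} {B C : ℝ} (hB : ∀ i, ‖fderiv ℝ (P.g i) x‖ ≤ B)
    (hC : ‖fderivWithin ℝ ψ.toFun (orthant m) (vmax (P.gvec x) 0)‖ ≤ C) :
    ‖P.bDeriv ψ x‖ ≤ m * (C * B) := by
  have h0 : 0 ≤ C := (norm_nonneg _).trans hC
  refine (norm_sum_le _ _).trans ((Finset.sum_le_sum (g := fun _ => C * B) fun i _ => ?_).trans
    (by simp))
  rw [norm_smul]
  refine mul_le_mul ?_ (hB i) (norm_nonneg _) h0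
  exact (ContinuousLinearMap.le_opNorm _ _).trans (by simpa using hC)

end Problem

/-! ### The Riesz map and the Hilbert product -/

/-- The real inner product as a continuous bilinear map. -/
def realInner (E : Type*) [NormedAddCommGroup E] [InnerProductSpace ℝ E] : E →L[ℝ] E →L[ℝ] ℝ :=
  (innerₗ E).mkContinuous₂ 1 fun x y => by simpa using norm_inner_le_norm (𝕜 := ℝ) x y

@[simp] theorem realInner_apply {E : Type*} [NormedAddCommGroup E] [InnerProductSpace ℝ E]
    (x y : E) : realInner E x y = inner ℝ x y := rfl

/-- The Riesz isomorphism of a real Hilbert space as a continuous linear map. -/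
def riesz (E : Type*) [NormedAddCommGroup E] [InnerProductSpace ℝ E] [CompleteSpace E] :
    (E →L[ℝ] ℝ) →L[ℝ] E :=
  LinearMap.mkContinuous
    { toFun := (InnerProductSpace.toDual ℝ E).symm
      map_add' := map_add _
      map_smul' := fun c y => by simp } 1 fun y => by simp

theorem riesz_apply {E : Type*} [NormedAddCommGroup E] [InnerProductSpace ℝ E] [CompleteSpace E]
    (y : E →L[ℝ] ℝ) : riesz E y = (InnerProductSpace.toDual ℝ E).symm y := rfl

theorem inner_riesz {E : Type*} [NormedAddCommGroup E] [InnerProductSpace ℝ E] [CompleteSpace E]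
    (y : E →L[ℝ] ℝ) (h : E) : inner ℝ (riesz E y) h = y h :=
  InnerProductSpace.toDual_symm_apply

theorem norm_riesz {E : Type*} [NormedAddCommGroup E] [InnerProductSpace ℝ E] [CompleteSpace E]
    (y : E →L[ℝ] ℝ) : ‖riesz E y‖ = ‖y‖ :=
  LinearIsometryEquiv.norm_map _ _

section Projections

variable (X H : Type*) [NormedAddCommGroup X] [InnerProductSpace ℝ X]
  [NormedAddCommGroup H] [InnerProductSpace ℝ H] (m : ℕ)

/-- The projection of the Hilbert product onto its first factor. -/
def projX : Prod3 X H m →L[ℝ] X := WithLp.fstL 2 ℝ X (WithLp 2 (H × Vec m))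

/-- The projection of the Hilbert product onto its second factor. -/
def projH : Prod3 X H m →L[ℝ] H :=
  (WithLp.fstL 2 ℝ H (Vec m)).comp (WithLp.sndL 2 ℝ X (WithLp 2 (H × Vec m)))

/-- The projection of the Hilbert product onto its third factor. -/
def projV : Prod3 X H m →L[ℝ] Vec m :=
  (WithLp.sndL 2 ℝ H (Vec m)).comp (WithLp.sndL 2 ℝ X (WithLp 2 (H × Vec m)))

variable {X H m}

@[simp] theorem projX_mk3 (x : X) (lam : H) (mu : Vec m) : projX X H m (mk3 x lam mu) = x := rfl

@[simp] theorem projH_mk3 (x : X) (lam : H) (mu : Vec m) : projH X H m (mk3 x lam mu) = lam := rfl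

@[simp] theorem projV_mk3 (x : X) (lam : H) (mu : Vec m) : projV X H m (mk3 x lam mu) = mu := rfl

theorem norm_mk3_left (x : X) : ‖mk3 x (0 : H) (0 : Vec m)‖ = ‖x‖ := by
  simp [mk3, WithLp.prod_norm_eq_of_L2]

theorem norm_mk3_mid (l : H) : ‖mk3 (0 : X) l (0 : Vec m)‖ = ‖l‖ := by
  simp [mk3]

theorem norm_mk3_right (k : Vec m) : ‖mk3 (0 : X) (0 : H) k‖ = ‖k‖ := by
  simp [mk3]

/-- The `i`-th coordinate of the third factor. -/
def coordV (X H : Type*) [NormedAddCommGroup X] [InnerProductSpace ℝ X]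
    [NormedAddCommGroup H] [InnerProductSpace ℝ H] {m : ℕ} (i : Fin m) : Prod3 X H m →L[ℝ] ℝ :=
  (EuclideanSpace.proj i : Vec m →L[ℝ] ℝ).comp (projV X H m)

@[simp] theorem coordV_mk3 (x : X) (lam : H) (mu : Vec m) (i : Fin m) :
    coordV X H i (mk3 x lam mu) = mu i := rfl

end Projections

/-! ### The Lagrangian and the derivative of `η` -/

namespace Problem

variable {X H : Type*} [NormedAddCommGroup X] [InnerProductSpace ℝ X] [CompleteSpace X]
  [NormedAddCommGroup H] [InnerProductSpace ℝ H] [CompleteSpace H] {m : ℕ}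
  (P : Problem X H m) (x : X) (lam : H) (mu : Vec m)

/-- `DF(x)^*[l] + ∑ k_i ∇g_i(x)`. -/
def adjMap (l : H) (k : Vec m) : X :=
  ContinuousLinearMap.adjoint (fderiv ℝ P.F x) l + ∑ i, k i • gradient (P.g i) x

theorem inner_adjMap (l : H) (k : Vec m) (h : X) :
    inner ℝ (P.adjMap x l k) h =
      inner ℝ l (fderiv ℝ P.F x h) + ∑ i, k i * fderiv ℝ (P.g i) x h := by
  simp [adjMap, inner_add_left, ContinuousLinearMap.adjoint_inner_left, sum_inner,
    real_inner_smul_left, inner_gradient_left]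

theorem gradg_apply (y : X) (i : Fin m) : P.gradg x y i = fderiv ℝ (P.g i) x y :=
  inner_gradient_left

theorem gradg_add (y z : X) : P.gradg x (y + z) = P.gradg x y + P.gradg x z := by
  ext i
  simp [gradg_apply]

theorem diagSq_add (y z : Vec m) : P.diagSq x (y + z) = P.diagSq x y + P.diagSq x z := by
  ext i
  simp [diagSq, mul_add]

theorem inner_vec (y z : Vec m) : inner ℝ y z = ∑ i, y i * z i := by
  simp [PiLp.inner_apply, mul_comm]

/-- `adjMap` is the adjoint of `y ↦ (DF(x)[y], ∇g(x) y)`; this is the Gram form of that map, the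
source of the symmetry used for `η`. -/
theorem inner_adjMap_adjMap (l l' : H) (k k' : Vec m) :
    inner ℝ (P.adjMap x l k) (P.adjMap x l' k') =
      inner ℝ (fderiv ℝ P.F x (P.adjMap x l k)) l' + inner ℝ (P.gradg x (P.adjMap x l k)) k' := by
  rw [real_inner_comm, inner_adjMap, real_inner_comm, inner_vec]
  simp [gradg_apply, mul_comm]

/-- The derivative of the Lagrangian in `x`, as a functional. -/
def dLag (x : X) (lam : H) (mu : Vec m) : X →L[ℝ] ℝ :=
  fderiv ℝ P.f x + (realInner H lam).comp (fderiv ℝ P.F x) + ∑ i, mu i • fderiv ℝ (P.g i) x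

theorem gradLagrangian_eq_riesz : P.gradLagrangian x lam mu = riesz X (P.dLag x lam mu) := by
  refine HasGradientAt.gradient (hasGradientAt_iff_hasFDerivAt.2 ?_)
  rw [riesz_apply, LinearIsometryEquiv.apply_symm_apply]
  simp only [lagrangian, inner_vec]
  exact ((P.hasFDerivAt_f x).add ((realInner H lam).hasFDerivAt.comp x (P.hasFDerivAt_F x))).add
    (HasFDerivAt.fun_sum fun i _ => (P.hasFDerivAt_g i x).const_mul (mu i))

theorem gradLagrangian_eq :
    P.gradLagrangian x lam mu = gradient P.f x + P.adjMap x lam mu := by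
  refine ext_inner_right ℝ fun h => ?_
  rw [gradLagrangian_eq_riesz, inner_riesz, inner_add_left, inner_adjMap, inner_gradient_left]
  simp [dLag, add_assoc]

/-- The derivative of `dLag` in `x` alone. -/
def d2Lag : X →L[ℝ] X →L[ℝ] ℝ :=
  fderiv ℝ (fderiv ℝ P.f) x
    + (ContinuousLinearMap.compL ℝ X H ℝ (realInner H lam)).comp (fderiv ℝ (fderiv ℝ P.F) x)
    + ∑ i, mu i • fderiv ℝ (fderiv ℝ (P.g i)) x

/-- `f`, `F` and the `g i` are twice differentiable at `x`. -/
def TwiceDiffAt : Prop :=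
  DifferentiableAt ℝ (fderiv ℝ P.f) x ∧ DifferentiableAt ℝ (fderiv ℝ P.F) x ∧
    ∀ i, DifferentiableAt ℝ (fderiv ℝ (P.g i)) x

variable {P x}

/-- The Lagrangian is affine in the multipliers, so its mixed second derivative is `adjMap` and the
Hessian enters only through the `x`-direction. -/
theorem TwiceDiffAt.hasFDerivAt_dLag (h : P.TwiceDiffAt x) :
    ∃ D : Prod3 X H m →L[ℝ] X →L[ℝ] ℝ,
      HasFDerivAt (fun z => P.dLag (projX X H m z) (projH X H m z) (projV X H m z)) D
        (mk3 x lam mu) ∧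
      ∀ y l k, riesz X (D (mk3 y l k)) = riesz X (P.d2Lag x lam mu y) + P.adjMap x l k := by
  set z := mk3 x lam mu
  have h1 : HasFDerivAt (fun z => fderiv ℝ P.f (projX X H m z)) _ z :=
    HasFDerivAt.comp z (h.1.hasFDerivAt) (projX X H m).hasFDerivAt
  have h2 : HasFDerivAt (fun z => fderiv ℝ P.F (projX X H m z)) _ z :=
    HasFDerivAt.comp z (h.2.1.hasFDerivAt) (projX X H m).hasFDerivAt
  have h3 : ∀ i, HasFDerivAt (fun z => fderiv ℝ (P.g i) (projX X H m z)) _ z := fun i =>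
    HasFDerivAt.comp z ((h.2.2 i).hasFDerivAt) (projX X H m).hasFDerivAt
  have h4 : HasFDerivAt (fun z => realInner H (projH X H m z)) _ z :=
    ((realInner H).comp (projH X H m)).hasFDerivAt
  refine ⟨_, (h1.add (h4.clm_comp h2)).add (HasFDerivAt.fun_sum fun i _ =>
    (coordV X H i).hasFDerivAt.smul (h3 i)), fun y l k => ?_⟩
  refine ext_inner_right ℝ fun w => ?_
  rw [inner_add_left, inner_riesz, inner_riesz, inner_adjMap]
  simp [d2Lag, Finset.sum_add_distrib, z]
  ring

variable (P x)

/-- `DF(x)[∇_x L]`. -/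
def resF : H := fderiv ℝ P.F x (P.gradLagrangian x lam mu)

/-- `∇g(x) ∇_x L + diag(g(x)^2) μ`. -/
def resG : Vec m := P.gradg x (P.gradLagrangian x lam mu) + P.diagSq x mu

variable {P x}

/-- The residuals are affine in `(λ, μ)` with self-adjoint linear part `N`, so the multiplier
gradient of `η` is `N` applied to the residuals, the very expression whose norm `Q` measures. -/
theorem TwiceDiffAt.hasFDerivAt_eta (h : P.TwiceDiffAt x) :
    ∃ D : Prod3 X H m →L[ℝ] ℝ,
      HasFDerivAt (fun z : Prod3 X H m => P.eta z.fst z.snd.fst z.snd.snd) D (mk3 x lam mu) ∧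
      (∀ y, D (mk3 y 0 0) =
        inner ℝ (P.resF x lam mu)
          (fderiv ℝ (fderiv ℝ P.F) x y (P.gradLagrangian x lam mu)
            + fderiv ℝ P.F x (riesz X (P.d2Lag x lam mu y)))
        + ∑ i, P.resG x lam mu i *
          (fderiv ℝ (fderiv ℝ (P.g i)) x y (P.gradLagrangian x lam mu)
            + fderiv ℝ (P.g i) x (riesz X (P.d2Lag x lam mu y))
            + 2 * P.g i x * fderiv ℝ (P.g i) x y * mu i)) ∧
      (∀ l, D (mk3 0 l 0) =
        inner ℝ (fderiv ℝ P.F x (P.adjMap x (P.resF x lam mu) (P.resG x lam mu))) l) ∧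
      ∀ k, D (mk3 0 0 k) =
        inner ℝ (P.gradg x (P.adjMap x (P.resF x lam mu) (P.resG x lam mu))
          + P.diagSq x (P.resG x lam mu)) k := by
  set z := mk3 x lam mu
  obtain ⟨D, hD, hDe⟩ := h.hasFDerivAt_dLag lam mu
  have h0 : HasFDerivAt (fun z => riesz X (P.dLag (projX X H m z) (projH X H m z)
      (projV X H m z))) _ z := (riesz X).hasFDerivAt.comp z hD
  have h2 : HasFDerivAt (fun z => fderiv ℝ P.F (projX X H m z)) _ z :=
    HasFDerivAt.comp z (h.2.1.hasFDerivAt) (projX X H m).hasFDerivAt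
  have h3 : ∀ i, HasFDerivAt (fun z => fderiv ℝ (P.g i) (projX X H m z)) _ z := fun i =>
    HasFDerivAt.comp z ((h.2.2 i).hasFDerivAt) (projX X H m).hasFDerivAt
  have h5 : ∀ i, HasFDerivAt (fun z => P.g i (projX X H m z)) _ z := fun i =>
    HasFDerivAt.comp z (P.hasFDerivAt_g i _) (projX X H m).hasFDerivAt
  have hu := ((h2.clm_apply h0).norm_sq).const_mul (1 / 2 : ℝ)
  have hv := (HasFDerivAt.fun_sum (u := Finset.univ) fun i _ =>
    (((h3 i).clm_apply h0).add (((h5 i).pow 2).mul (coordV X H i).hasFDerivAt)).pow 2).const_mul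
      (1 / 2 : ℝ)
  obtain ⟨D', hD', key⟩ : ∃ D' : Prod3 X H m →L[ℝ] ℝ,
      HasFDerivAt (fun z : Prod3 X H m => P.eta z.fst z.snd.fst z.snd.snd) D' z ∧
      ∀ y l k, D' (mk3 y l k) =
        inner ℝ (P.resF x lam mu)
          (fderiv ℝ (fderiv ℝ P.F) x y (P.gradLagrangian x lam mu)
            + fderiv ℝ P.F x (riesz X (P.d2Lag x lam mu y) + P.adjMap x l k))
        + ∑ i, P.resG x lam mu i *
          (fderiv ℝ (fderiv ℝ (P.g i)) x y (P.gradLagrangian x lam mu)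
            + fderiv ℝ (P.g i) x (riesz X (P.d2Lag x lam mu y) + P.adjMap x l k)
            + 2 * P.g i x * fderiv ℝ (P.g i) x y * mu i + P.g i x ^ 2 * k i) := by
    refine ⟨_, (hu.add hv).congr_of_eventuallyEq (Filter.Eventually.of_forall fun w => ?_),
      fun y l k => ?_⟩
    · simp only [eta, EuclideanSpace.real_norm_sq_eq, PiLp.add_apply, gradg_apply,
        gradLagrangian_eq_riesz]
      rfl
    · have hG : ∀ i, P.resG x lam mu i =
          fderiv ℝ (P.g i) x (riesz X (P.dLag x lam mu)) + P.g i x ^ 2 * mu i := fun i => by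
        rw [← gradLagrangian_eq_riesz, ← gradg_apply]
        rfl
      simp only [hG, resF, gradLagrangian_eq_riesz, ← hDe]
      simp only [z, one_div, nsmul_eq_mul, Nat.cast_ofNat, add_apply, smul_apply,
        ContinuousLinearMap.comp_apply, ContinuousLinearMap.flip_apply, projX_mk3, projH_mk3,
        projV_mk3, coordV_mk3, smul_eq_mul, sum_apply, innerSL_apply_apply]
      congr 1
      · rw [add_comm (fderiv ℝ P.F x _)]
        ring_nf
      · rw [Finset.mul_sum]
        refine Finset.sum_congr rfl fun i _ => ?_
        simp
        ring
  refine ⟨D', hD', fun y => ?_, fun l => ?_, fun k => ?_⟩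
  · rw [key]
    simp [adjMap]
  -- Padding with a zero in the other slot lets the Gram identity turn the derivative into an inner
  -- product with `l`.
  · rw [key, ← add_zero (inner ℝ _ l), ← inner_zero_right (𝕜 := ℝ)
      (P.gradg x (P.adjMap x (P.resF x lam mu) (P.resG x lam mu))), ← inner_adjMap_adjMap,
      inner_adjMap]
    simp
  · rw [key, inner_add_left, ← zero_add (inner ℝ _ k), ← inner_zero_right (𝕜 := ℝ)
      (fderiv ℝ P.F x (P.adjMap x (P.resF x lam mu) (P.resG x lam mu))), ← inner_adjMap_adjMap,
      inner_adjMap, inner_vec]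
    simp [mul_add, Finset.sum_add_distrib, diagSq, add_assoc]
    exact Finset.sum_congr rfl fun i _ => by ring

end Problem

/-! ### The gradient of the augmented Lagrangian -/

namespace Problem

variable {X H : Type*} [NormedAddCommGroup X] [InnerProductSpace ℝ X] [CompleteSpace X]
  [NormedAddCommGroup H] [InnerProductSpace ℝ H] [CompleteSpace H] {m : ℕ}
  {P : Problem X H m} {φ : PenaltyFunction} {ψ : WeightFunction m} {x : X} {lam : H} {mu : Vec m}
  {c T : ℝ}

theorem p_pos (hb : 0 < P.b ψ x) : 0 < P.p ψ x mu := div_pos hb (by positivity)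

theorem q_apply (i : Fin m) : P.q ψ x mu c i = max (P.g i x) (-(P.p ψ x mu / c) * mu i) := by
  simp [q, vmax, gvec]

theorem sum_ineqTerm :
    ∑ i, ineqTerm c (P.g i x) (P.p ψ x mu) (mu i) =
      inner ℝ mu (P.q ψ x mu c) + c / (2 * P.p ψ x mu) * ‖P.q ψ x mu c‖ ^ 2 := by
  simp only [ineqTerm, inner_vec, EuclideanSpace.real_norm_sq_eq, Finset.sum_add_distrib,
    Finset.mul_sum, q_apply]

theorem augLag_of_mem (hx : x ∈ P.Omega φ ψ) :
    P.augLag φ ψ x lam mu c =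
      ((P.f x + inner ℝ lam (P.F x) + c / 2 * (1 + ‖lam‖ ^ 2) * φ.real (‖P.F x‖ ^ 2)
        + ∑ i, ineqTerm c (P.g i x) (P.p ψ x mu) (mu i) + P.eta x lam mu : ℝ) : EReal) := by
  rw [augLag, if_pos hx, sum_ineqTerm, toFun_nnnorm_sq, PenaltyFunction.real]
  congr 1
  ring

/-- `Ω` need not be open, since the effective domain of `φ` may contain its right endpoint. Staying
strictly below some `T` in the domain avoids this boundary. -/
theorem Omega_mem_nhds (hx : x ∈ P.Omega φ ψ) (hT : T ∈ φ.dom) (hxT : ‖P.F x‖ ^ 2 < T) :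
    P.Omega φ ψ ∈ nhds x := by
  filter_upwards [(P.hasFDerivAt_b ψ x).continuousAt.eventually (lt_mem_nhds hx.1),
    ((P.hasFDerivAt_F x).continuousAt.norm.pow 2).eventually (gt_mem_nhds hxT)] with y hb hy
  exact ⟨hb, toFun_nnnorm_sq_lt_top_iff.2 (φ.mem_dom_of_le hT (sq_nonneg _) hy.le)⟩

theorem twiceDiffAt_of_mem_nhds (hf : ContDiffOn ℝ 2 P.f (P.Omega φ ψ))
    (hF : ContDiffOn ℝ 2 P.F (P.Omega φ ψ)) (hg : ∀ i, ContDiffOn ℝ 2 (P.g i) (P.Omega φ ψ))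
    (hx : P.Omega φ ψ ∈ nhds x) : P.TwiceDiffAt x :=
  have h12 : (1 : WithTop ℕ∞) + 1 ≤ 2 := by norm_num
  ⟨((hf.contDiffAt hx).fderiv_right h12).differentiableAt one_ne_zero,
    ((hF.contDiffAt hx).fderiv_right h12).differentiableAt one_ne_zero,
    fun i => (((hg i).contDiffAt hx).fderiv_right h12).differentiableAt one_ne_zero⟩

theorem hasFDerivAt_p (hb : 0 < P.b ψ x) :
    ∃ D : Prod3 X H m →L[ℝ] ℝ,
      HasFDerivAt (fun z => P.p ψ (projX X H m z) (projV X H m z)) D (mk3 x lam mu) ∧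
      ∀ y l k, D (mk3 y l k) = P.p ψ x mu / P.b ψ x * P.bDeriv ψ x y
        - 2 * (P.p ψ x mu ^ 2 / P.b ψ x) * inner ℝ mu k := by
  set z := mk3 x lam mu
  have hne : (1 : ℝ) + ‖mu‖ ^ 2 ≠ 0 := by positivity
  have h1 : HasFDerivAt (fun z => P.b ψ (projX X H m z)) _ z :=
    HasFDerivAt.comp (g := P.b ψ) z (P.hasFDerivAt_b ψ x) (projX X H m).hasFDerivAt
  have h2 : HasFDerivAt (fun z => (1 : ℝ) + ‖projV X H m z‖ ^ 2) _ z :=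
    ((projV X H m).hasFDerivAt.norm_sq).const_add 1
  have h3 : HasFDerivAt (fun z => ((1 : ℝ) + ‖projV X H m z‖ ^ 2)⁻¹) _ z :=
    HasDerivAt.comp_hasFDerivAt z (hasDerivAt_inv hne) h2
  refine ⟨_, h1.mul h3, fun y l k => ?_⟩
  have hb' := hb.ne'
  simp [z, p]
  field_simp
  ring

/-- `φ` is differentiable only within its domain, but `‖F‖²` maps the neighbourhood `Ω` of `x` into
that domain, so the chain rule yields a full derivative. -/
theorem hasFDerivAt_penalty (hφ : φ.IsC1) (hx : x ∈ P.Omega φ ψ) (hT : T ∈ φ.dom)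
    (hxT : ‖P.F x‖ ^ 2 < T) :
    HasFDerivAt (fun y => φ.real (‖P.F y‖ ^ 2))
      ((2 * derivWithin φ.real φ.dom (‖P.F x‖ ^ 2)) •
        (realInner H (P.F x)).comp (fderiv ℝ P.F x)) x := by
  have h1 := (P.hasFDerivAt_F x).norm_sq
  have h2 := hφ.hasDerivWithinAt (toFun_nnnorm_sq_lt_top_iff.1 hx.2)
  have h3 := h2.comp_hasFDerivWithinAt x (h1.hasFDerivWithinAt (s := P.Omega φ ψ))
    fun y hy => toFun_nnnorm_sq_lt_top_iff.1 hy.2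
  refine (h3.hasFDerivAt (Omega_mem_nhds hx hT hxT)).congr_fderiv ?_
  ext y
  simp
  ring

/-- Differentiating the weight `p` produces the two terms with `‖q‖²`; they are errors of order `c
‖q‖²`. The leading `x`-part has the form `∇_x L + adjMap z₁ z₂` with `z₁`, `z₂` of size `c` times
the infeasibility. -/
theorem hasFDerivAt_augLagReal (hφ : φ.IsC1) (hx : x ∈ P.Omega φ ψ) (hT : T ∈ φ.dom)
    (hxT : ‖P.F x‖ ^ 2 < T) (h2 : P.TwiceDiffAt x) (hc : 0 < c) :
    ∃ D : Prod3 X H m →L[ℝ] ℝ,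
      HasFDerivAt (P.augLagReal φ ψ c) D (mk3 x lam mu) ∧
      (∀ y, D (mk3 y 0 0) =
        inner ℝ (P.gradLagrangian x lam mu + P.adjMap x
          ((c * (1 + ‖lam‖ ^ 2) * derivWithin φ.real φ.dom (‖P.F x‖ ^ 2)) • P.F x)
          ((c / P.p ψ x mu) • P.q ψ x mu c)) y
        - c / (2 * P.p ψ x mu * P.b ψ x) * ‖P.q ψ x mu c‖ ^ 2 * P.bDeriv ψ x y
        + (inner ℝ (P.resF x lam mu)
            (fderiv ℝ (fderiv ℝ P.F) x y (P.gradLagrangian x lam mu)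
              + fderiv ℝ P.F x (riesz X (P.d2Lag x lam mu y)))
          + ∑ i, P.resG x lam mu i *
            (fderiv ℝ (fderiv ℝ (P.g i)) x y (P.gradLagrangian x lam mu)
              + fderiv ℝ (P.g i) x (riesz X (P.d2Lag x lam mu y))
              + 2 * P.g i x * fderiv ℝ (P.g i) x y * mu i))) ∧
      (∀ l, D (mk3 0 l 0) =
        inner ℝ (P.F x + (c * φ.real (‖P.F x‖ ^ 2)) • lam
          + fderiv ℝ P.F x (P.adjMap x (P.resF x lam mu) (P.resG x lam mu))) l) ∧
      ∀ k, D (mk3 0 0 k) =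
        inner ℝ (P.q ψ x mu c + (c / P.b ψ x * ‖P.q ψ x mu c‖ ^ 2) • mu
          + (P.gradg x (P.adjMap x (P.resF x lam mu) (P.resG x lam mu))
            + P.diagSq x (P.resG x lam mu))) k := by
  set z := mk3 x lam mu
  obtain ⟨De, hDe, hDx, hDl, hDm⟩ := h2.hasFDerivAt_eta lam mu
  obtain ⟨Dp, hDp, hDp'⟩ := P.hasFDerivAt_p (ψ := ψ) (lam := lam) (mu := mu) hx.1
  have hp : 0 < P.p ψ x mu := p_pos hx.1
  have h1 : HasFDerivAt (fun z => P.f (projX X H m z)) _ z :=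
    HasFDerivAt.comp z (P.hasFDerivAt_f x) (projX X H m).hasFDerivAt
  have h3 : HasFDerivAt (fun z => P.F (projX X H m z)) _ z :=
    HasFDerivAt.comp z (P.hasFDerivAt_F x) (projX X H m).hasFDerivAt
  have h4 : HasFDerivAt (fun z => inner ℝ (projH X H m z) (P.F (projX X H m z))) _ z :=
    (projH X H m).hasFDerivAt.inner ℝ h3
  have h5 : HasFDerivAt (fun z => φ.real (‖P.F (projX X H m z)‖ ^ 2)) _ z :=
    HasFDerivAt.comp (g := fun y => φ.real (‖P.F y‖ ^ 2)) z
      (hasFDerivAt_penalty hφ hx hT hxT) (projX X H m).hasFDerivAt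
  have h6 : HasFDerivAt (fun z => c / 2 * (1 + ‖projH X H m z‖ ^ 2)) _ z :=
    (((projH X H m).hasFDerivAt.norm_sq).const_add 1).const_mul (c / 2)
  have h7 : HasFDerivAt (fun z => ∑ i, ineqTerm c (P.g i (projX X H m z))
      (P.p ψ (projX X H m z) (projV X H m z)) (coordV X H i z)) _ z :=
    HasFDerivAt.fun_sum fun i _ => HasFDerivAt.ineqTerm hc
      (HasFDerivAt.comp z (P.hasFDerivAt_g i x) (projX X H m).hasFDerivAt) hDp
      (coordV X H i).hasFDerivAt hp (q := P.q ψ x mu c i) (P.q_apply i)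
  have hd := (((h1.add h4).add (h6.mul h5)).add h7).add hDe
  have hq : ∀ a : ℝ, ∑ i, c / (2 * P.p ψ x mu ^ 2) * P.q ψ x mu c i ^ 2 * a =
      c / (2 * P.p ψ x mu ^ 2) * ‖P.q ψ x mu c‖ ^ 2 * a := fun a => by
    rw [EuclideanSpace.real_norm_sq_eq, Finset.mul_sum, Finset.sum_mul]
  have hb := hx.1.ne'
  have hp' := hp.ne'
  refine ⟨_, hd.congr_of_eventuallyEq ?_, fun y => ?_, fun l => ?_, fun k => ?_⟩
  · filter_upwards [(projX X H m).continuous.continuousAt.eventually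
      (Omega_mem_nhds hx hT hxT : P.Omega φ ψ ∈ nhds (projX X H m z))] with w hw
    exact congrArg EReal.toReal (augLag_of_mem (P := P) (φ := φ) (ψ := ψ) hw)
  · simp only [add_apply, hDx]
    congr 1
    simp only [inner_add_left, inner_adjMap, gradLagrangian_eq, inner_gradient_left]
    simp [z, hDp', Finset.sum_sub_distrib, real_inner_smul_left, hq, add_mul]
    rw [Finset.sum_add_distrib]
    field_simp
    ring
  · simp only [add_apply, hDl, inner_add_left]
    simp [z, hDp', real_inner_smul_left]
    rw [real_inner_comm]
    ring
  · simp only [add_apply, hDm, inner_add_left]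
    simp [z, hDp', Finset.sum_sub_distrib, real_inner_smul_left, hq, inner_vec]
    field_simp

end Problem

/-! ### Uniform bounds from positive definiteness and `C²` data -/

/-- Used to bound a partial gradient by testing the derivative on the gradient itself. -/
theorem norm_le_of_inner_self_le {E : Type*} [NormedAddCommGroup E] [InnerProductSpace ℝ E]
    {w : E} {M : ℝ} (hM : 0 ≤ M) (h : inner ℝ w w ≤ M * ‖w‖) : ‖w‖ ≤ M := by
  rcases (norm_nonneg w).eq_or_lt with h0 | h0
  · rwa [← h0]
  · rw [real_inner_self_eq_norm_sq, sq] at h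
    exact le_of_mul_le_mul_right h h0

theorem abs_sum_mul_le {m : ℕ} (v : Vec m) {w : Fin m → ℝ} {M : ℝ} (h : ∀ i, |w i| ≤ M) :
    |∑ i, v i * w i| ≤ m * (‖v‖ * M) := by
  refine (Finset.abs_sum_le_sum_abs _ _).trans
    ((Finset.sum_le_sum (g := fun _ => ‖v‖ * M) fun i _ => ?_).trans (by simp))
  rw [abs_mul]
  exact mul_le_mul (abs_coord_le_norm v i) (h i) (abs_nonneg _) (norm_nonneg _)

theorem norm_le_card_mul {m : ℕ} {v : Vec m} {M : ℝ} (h : ∀ i, |v i| ≤ M) : ‖v‖ ≤ m * M :=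
  (norm_le_sum_abs v).trans ((Finset.sum_le_sum (g := fun _ => M) fun i _ => h i).trans (by simp))

namespace Problem

variable {X H : Type*} [NormedAddCommGroup X] [InnerProductSpace ℝ X] [CompleteSpace X]
  [NormedAddCommGroup H] [InnerProductSpace ℝ H] [CompleteSpace H] {m : ℕ}

/-- `B` bounds `f`, `F`, `g i` and their first two derivatives at `x`. -/
structure C2BoundAt (P : Problem X H m) (B : ℝ) (x : X) : Prop where
  f_zero : ‖P.f x‖ ≤ B
  f_one : ‖fderiv ℝ P.f x‖ ≤ B
  f_two : ‖fderiv ℝ (fderiv ℝ P.f) x‖ ≤ B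
  F_zero : ‖P.F x‖ ≤ B
  F_one : ‖fderiv ℝ P.F x‖ ≤ B
  F_two : ‖fderiv ℝ (fderiv ℝ P.F) x‖ ≤ B
  g_zero : ∀ i, ‖P.g i x‖ ≤ B
  g_one : ∀ i, ‖fderiv ℝ (P.g i) x‖ ≤ B
  g_two : ∀ i, ‖fderiv ℝ (fderiv ℝ (P.g i)) x‖ ≤ B

variable {P : Problem X H m} {φ : PenaltyFunction} {ψ : WeightFunction m} {x : X} {lam : H}
  {mu : Vec m} {c T a B R : ℝ}

theorem Admissible.exists_c2BoundAt {V : Set X} (h : P.Admissible φ ψ V) :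
    ∃ B ≥ 0, ∀ x ∈ V, P.C2BoundAt B x := by
  obtain ⟨-, -, -, ⟨Bf, hf⟩, ⟨BF, hF⟩, hg⟩ := h
  choose Bg hg using hg
  have h0 : 0 ≤ ∑ i, |Bg i| := Finset.sum_nonneg fun _ _ => abs_nonneg _
  have h1 : ∀ i, |Bg i| ≤ ∑ i, |Bg i| := fun i =>
    Finset.single_le_sum (f := fun i => |Bg i|) (fun _ _ => abs_nonneg _) (Finset.mem_univ i)
  have hf0 := abs_nonneg Bf
  have hF0 := abs_nonneg BF
  have e1 : Bf ≤ |Bf| + |BF| + ∑ i, |Bg i| := by linarith [le_abs_self Bf]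
  have e2 : BF ≤ |Bf| + |BF| + ∑ i, |Bg i| := by linarith [le_abs_self BF]
  have e3 : ∀ i, Bg i ≤ |Bf| + |BF| + ∑ i, |Bg i| := fun i => by
    linarith [le_abs_self (Bg i), h1 i]
  exact ⟨|Bf| + |BF| + ∑ i, |Bg i|, by positivity, fun x hx =>
    ⟨(hf x hx).1.trans e1, (hf x hx).2.1.trans e1, (hf x hx).2.2.trans e1,
      (hF x hx).1.trans e2, (hF x hx).2.1.trans e2, (hF x hx).2.2.trans e2,
      fun i => (hg i x hx).1.trans (e3 i), fun i => (hg i x hx).2.1.trans (e3 i),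
      fun i => (hg i x hx).2.2.trans (e3 i)⟩⟩

/-- The factors `½` in `Q` cancel the `2` in `(s + t)² ≤ 2 (s² + t²)`, giving positive definiteness
in the linear form that suits the triangle inequality. -/
theorem sqrt_mul_add_le (ha : 0 < a)
    (hQ : ∀ (l : H) (k : Vec m), a * (‖l‖ ^ 2 + ‖k‖ ^ 2) ≤ P.Q x l k) (l : H) (k : Vec m) :
    √a * (‖l‖ + ‖k‖) ≤ ‖fderiv ℝ P.F x (P.adjMap x l k)‖
      + ‖P.gradg x (P.adjMap x l k) + P.diagSq x k‖ := by
  have h := hQ l k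
  rw [Q] at h
  change _ ≤ 1 / 2 * ‖fderiv ℝ P.F x (P.adjMap x l k)‖ ^ 2
    + 1 / 2 * ‖P.gradg x (P.adjMap x l k) + P.diagSq x k‖ ^ 2 at h
  refine (pow_le_pow_iff_left₀ (by positivity) (by positivity) two_ne_zero).1 ?_
  rw [mul_pow, Real.sq_sqrt ha.le]
  nlinarith [mul_nonneg ha.le (sq_nonneg (‖l‖ - ‖k‖)),
    mul_nonneg (norm_nonneg (fderiv ℝ P.F x (P.adjMap x l k)))
      (norm_nonneg (P.gradg x (P.adjMap x l k) + P.diagSq x k))]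

namespace C2BoundAt

variable (hB : P.C2BoundAt B x)
include hB

theorem nonneg : 0 ≤ B := (norm_nonneg _).trans hB.f_zero

theorem norm_fderiv_F_apply_le (y : X) : ‖fderiv ℝ P.F x y‖ ≤ B * ‖y‖ :=
  ContinuousLinearMap.le_of_opNorm_le _ hB.F_one y

theorem abs_fderiv_g_apply_le (i : Fin m) (y : X) : |fderiv ℝ (P.g i) x y| ≤ B * ‖y‖ :=
  ContinuousLinearMap.le_of_opNorm_le _ (hB.g_one i) y

theorem norm_gradg_le (y : X) : ‖P.gradg x y‖ ≤ m * (B * ‖y‖) :=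
  norm_le_card_mul fun i => by
    rw [gradg_apply]
    exact hB.abs_fderiv_g_apply_le i y

theorem norm_gradLagrangian_le (hlam : ‖lam‖ ≤ R) (hmu : ‖mu‖ ≤ R) :
    ‖P.gradLagrangian x lam mu‖ ≤ B + R * B + m * (R * B) := by
  have h0 := hB.nonneg
  have hR : 0 ≤ R := (norm_nonneg _).trans hlam
  rw [gradLagrangian_eq_riesz, norm_riesz]
  refine ContinuousLinearMap.opNorm_le_bound _ (by positivity) fun y => ?_
  have h1 : |fderiv ℝ P.f x y| ≤ B * ‖y‖ := ContinuousLinearMap.le_of_opNorm_le _ hB.f_one y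
  have h2 : |inner ℝ lam (fderiv ℝ P.F x y)| ≤ R * (B * ‖y‖) :=
    (abs_real_inner_le_norm _ _).trans
      (mul_le_mul hlam (hB.norm_fderiv_F_apply_le y) (norm_nonneg _) hR)
  have h3 := abs_sum_mul_le mu fun i => hB.abs_fderiv_g_apply_le i y
  have h4 : ‖mu‖ * (B * ‖y‖) ≤ R * (B * ‖y‖) := by gcongr
  have h5 : (m : ℝ) * (‖mu‖ * (B * ‖y‖)) ≤ m * (R * (B * ‖y‖)) := by gcongr
  have e : P.dLag x lam mu y = fderiv ℝ P.f x y + inner ℝ lam (fderiv ℝ P.F x y)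
      + ∑ i, mu i * fderiv ℝ (P.g i) x y := by simp [dLag]
  rw [e, Real.norm_eq_abs]
  linarith [abs_add_three (fderiv ℝ P.f x y) (inner ℝ lam (fderiv ℝ P.F x y))
    (∑ i, mu i * fderiv ℝ (P.g i) x y)]

theorem norm_d2Lag_apply_le (hlam : ‖lam‖ ≤ R) (hmu : ‖mu‖ ≤ R) (y : X) :
    ‖P.d2Lag x lam mu y‖ ≤ (B + R * B + m * (R * B)) * ‖y‖ := by
  have h0 := hB.nonneg
  have hR : 0 ≤ R := (norm_nonneg _).trans hlam
  refine ContinuousLinearMap.opNorm_le_bound _ (by positivity) fun w => ?_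
  have h1 : |fderiv ℝ (fderiv ℝ P.f) x y w| ≤ B * ‖y‖ * ‖w‖ :=
    ContinuousLinearMap.le_of_opNorm₂_le_of_le _ hB.f_two le_rfl le_rfl
  have h2 : |inner ℝ lam (fderiv ℝ (fderiv ℝ P.F) x y w)| ≤ R * (B * ‖y‖ * ‖w‖) :=
    (abs_real_inner_le_norm _ _).trans (mul_le_mul hlam
      (ContinuousLinearMap.le_of_opNorm₂_le_of_le _ hB.F_two le_rfl le_rfl) (norm_nonneg _) hR)
  have h3 := abs_sum_mul_le mu (w := fun i => fderiv ℝ (fderiv ℝ (P.g i)) x y w)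
    (M := B * ‖y‖ * ‖w‖) fun i =>
      ContinuousLinearMap.le_of_opNorm₂_le_of_le _ (hB.g_two i) le_rfl le_rfl
  have h5 : (m : ℝ) * (‖mu‖ * (B * ‖y‖ * ‖w‖)) ≤ m * (R * (B * ‖y‖ * ‖w‖)) := by gcongr
  have e : P.d2Lag x lam mu y w = fderiv ℝ (fderiv ℝ P.f) x y w
      + inner ℝ lam (fderiv ℝ (fderiv ℝ P.F) x y w)
      + ∑ i, mu i * fderiv ℝ (fderiv ℝ (P.g i)) x y w := by simp [d2Lag]
  rw [e, Real.norm_eq_abs]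
  linarith [abs_add_three (fderiv ℝ (fderiv ℝ P.f) x y w)
    (inner ℝ lam (fderiv ℝ (fderiv ℝ P.F) x y w))
    (∑ i, mu i * fderiv ℝ (fderiv ℝ (P.g i)) x y w)]

/-- The `x`-derivative of `η` is controlled by the residuals. -/
theorem abs_eta_deriv_le (hlam : ‖lam‖ ≤ R) (hmu : ‖mu‖ ≤ R) (y : X) :
    |inner ℝ (P.resF x lam mu)
        (fderiv ℝ (fderiv ℝ P.F) x y (P.gradLagrangian x lam mu)
          + fderiv ℝ P.F x (riesz X (P.d2Lag x lam mu y)))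
      + ∑ i, P.resG x lam mu i *
        (fderiv ℝ (fderiv ℝ (P.g i)) x y (P.gradLagrangian x lam mu)
          + fderiv ℝ (P.g i) x (riesz X (P.d2Lag x lam mu y))
          + 2 * P.g i x * fderiv ℝ (P.g i) x y * mu i)| ≤
      (1 + m) * (2 * B * (B + R * B + m * (R * B)) + 2 * B * B * R)
        * (‖P.resF x lam mu‖ + ‖P.resG x lam mu‖) * ‖y‖ := by
  have h0 := hB.nonneg
  have hR : 0 ≤ R := (norm_nonneg _).trans hlam
  set B' := B + R * B + m * (R * B) with hB'
  have hB'0 : 0 ≤ B' := by positivity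
  have hxi : ‖P.gradLagrangian x lam mu‖ ≤ B' := hB.norm_gradLagrangian_le hlam hmu
  have hxi' : ‖riesz X (P.d2Lag x lam mu y)‖ ≤ B' * ‖y‖ := by
    rw [norm_riesz]
    exact hB.norm_d2Lag_apply_le hlam hmu y
  set M := (2 * B * B' + 2 * B * B * R) * ‖y‖ with hM
  have hM0 : 0 ≤ M := by positivity
  have hu : ‖fderiv ℝ (fderiv ℝ P.F) x y (P.gradLagrangian x lam mu)
      + fderiv ℝ P.F x (riesz X (P.d2Lag x lam mu y))‖ ≤ M := by
    have e1 : ‖fderiv ℝ (fderiv ℝ P.F) x y (P.gradLagrangian x lam mu)‖ ≤ B * ‖y‖ * B' :=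
      ContinuousLinearMap.le_of_opNorm₂_le_of_le _ hB.F_two le_rfl hxi
    have e2 : ‖fderiv ℝ P.F x (riesz X (P.d2Lag x lam mu y))‖ ≤ B * (B' * ‖y‖) :=
      (hB.norm_fderiv_F_apply_le _).trans (by gcongr)
    have e3 : 0 ≤ 2 * B * B * R * ‖y‖ := by positivity
    refine (norm_add_le _ _).trans ?_
    rw [hM]
    linarith
  have hv : ∀ i, |fderiv ℝ (fderiv ℝ (P.g i)) x y (P.gradLagrangian x lam mu)
      + fderiv ℝ (P.g i) x (riesz X (P.d2Lag x lam mu y))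
      + 2 * P.g i x * fderiv ℝ (P.g i) x y * mu i| ≤ M := fun i => by
    have e1 : |fderiv ℝ (fderiv ℝ (P.g i)) x y (P.gradLagrangian x lam mu)| ≤ B * ‖y‖ * B' :=
      ContinuousLinearMap.le_of_opNorm₂_le_of_le _ (hB.g_two i) le_rfl hxi
    have e2 : |fderiv ℝ (P.g i) x (riesz X (P.d2Lag x lam mu y))| ≤ B * (B' * ‖y‖) :=
      (hB.abs_fderiv_g_apply_le i _).trans (by gcongr)
    have e3 : |2 * P.g i x * fderiv ℝ (P.g i) x y * mu i| ≤ 2 * B * (B * ‖y‖) * R := by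
      rw [abs_mul, abs_mul, abs_mul, abs_two]
      have := hB.g_zero i
      rw [Real.norm_eq_abs] at this
      exact mul_le_mul (mul_le_mul (by linarith) (hB.abs_fderiv_g_apply_le i y) (abs_nonneg _)
        (by positivity)) ((abs_coord_le_norm mu i).trans hmu) (abs_nonneg _) (by positivity)
    refine (abs_add_three _ _ _).trans ?_
    rw [hM]
    linarith
  have h1 := (abs_real_inner_le_norm (P.resF x lam mu) _).trans
    (mul_le_mul_of_nonneg_left hu (norm_nonneg _))
  have h2 := abs_sum_mul_le (P.resG x lam mu) hv
  refine (abs_add_le _ _).trans ((add_le_add h1 h2).trans ?_)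
  have e1 : 0 ≤ m * (‖P.resF x lam mu‖ * M) := by positivity
  have e2 : 0 ≤ ‖P.resG x lam mu‖ * M := by positivity
  rw [hM] at *
  linarith

/-- Complementarity: `diag(g²)(μ + (c/p) q)` is quadratic in `q`. -/
theorem norm_diagSq_le (hmu : ‖mu‖ ≤ R) (hp : 0 < P.p ψ x mu) (hpc : P.p ψ x mu ≤ c) :
    ‖P.diagSq x (mu + (c / P.p ψ x mu) • P.q ψ x mu c)‖ ≤
      m * (c / P.p ψ x mu * ‖P.q ψ x mu c‖ ^ 2 * (R + B)) := by
  have h0 := hB.nonneg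
  have hR : 0 ≤ R := (norm_nonneg _).trans hmu
  have hc : 0 < c := hp.trans_le hpc
  refine norm_le_card_mul fun i => ?_
  have e : P.diagSq x (mu + (c / P.p ψ x mu) • P.q ψ x mu c) i =
      P.g i x ^ 2 * (mu i + c / P.p ψ x mu * P.q ψ x mu c i) := by simp [diagSq]
  rw [e]
  -- If the maximum is `-p μ_i / c`, then `μ_i + (c/p) q_i = 0`. Otherwise `g_i = q_i`, and the
  -- factor `g_i²` supplies the square.
  rcases le_total (P.g i x) (-(P.p ψ x mu / c) * mu i) with h | h
  · have hz : mu i + c / P.p ψ x mu * P.q ψ x mu c i = 0 := by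
      rw [q_apply, max_eq_right h]
      field_simp
      ring
    rw [hz, mul_zero, abs_zero]
    positivity
  · have hq : P.q ψ x mu c i = P.g i x := by rw [q_apply, max_eq_left h]
    rw [← hq, abs_mul, abs_pow, mul_comm (c / P.p ψ x mu) (‖P.q ψ x mu c‖ ^ 2), mul_assoc]
    refine mul_le_mul (pow_le_pow_left₀ (abs_nonneg _) (abs_coord_le_norm _ i) 2) ?_
      (abs_nonneg _) (by positivity)
    refine (abs_add_le _ _).trans ?_
    rw [abs_mul, abs_of_pos (div_pos hc hp), hq, mul_add]
    -- Since `c ≥ p`, the bound `R` on `μ_i` may be inflated to `(c/p) R`, so that one factor serves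
    -- both summands.
    have h1 : 1 ≤ c / P.p ψ x mu := (one_le_div hp).2 hpc
    have h2 := (abs_coord_le_norm mu i).trans hmu
    have h3 := hB.g_zero i
    rw [Real.norm_eq_abs] at h3
    refine add_le_add (h2.trans (le_mul_of_one_le_left hR h1)) (by gcongr)

end C2BoundAt

end Problem

/-! ### The basic lower estimate of the gradient -/

theorem norm_right_le {E : Type*} [NormedAddCommGroup E] (y z : E) : ‖z‖ ≤ ‖y + z‖ + ‖y‖ := by
  simpa using norm_sub_le (y + z) y

namespace Problem

variable {X H : Type*} [NormedAddCommGroup X] [InnerProductSpace ℝ X] [CompleteSpace X]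
  [NormedAddCommGroup H] [InnerProductSpace ℝ H] [CompleteSpace H] {m : ℕ}
  {P : Problem X H m} {φ : PenaltyFunction} {ψ : WeightFunction m} {x : X} {lam : H}
  {mu : Vec m} {c T a B R : ℝ}

theorem p_le (hb : 0 < P.b ψ x) : P.p ψ x mu ≤ ψ.toFun 0 :=
  (div_le_self hb.le (by linarith [sq_nonneg ‖mu‖])).trans (P.b_le ψ x)

theorem inv_p_le (hb : ψ.toFun 0 / 2 ≤ P.b ψ x) (hmu : ‖mu‖ ≤ R) :
    (P.p ψ x mu)⁻¹ ≤ 2 * (1 + R ^ 2) / ψ.toFun 0 := by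
  have hpos := ψ.pos
  have hb0 : 0 < P.b ψ x := by linarith
  have : ‖mu‖ ^ 2 ≤ R ^ 2 := pow_le_pow_left₀ (norm_nonneg _) hmu 2
  rw [p, inv_div, div_le_div_iff₀ hb0 hpos]
  nlinarith [sq_nonneg ‖mu‖]

set_option maxHeartbeats 1000000 in
/-- The basic estimate of the gradient of the augmented Lagrangian from below. -/
theorem exists_gradient_estimate (hφ : φ.IsC1) (hφ0 : 0 < φ.derivZero) (hT : T ∈ φ.dom)
    (ha : 0 < a) (hR : 0 ≤ R) (hB0 : 0 ≤ B) {β Cφ : ℝ} (hβ : 0 ≤ β) (hCφ : 0 ≤ Cφ) :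
    ∃ C ≥ 0, ∀ x lam mu c, x ∈ P.Omega φ ψ → ‖P.F x‖ ^ 2 < T → P.TwiceDiffAt x →
      P.C2BoundAt B x → ‖lam‖ ≤ R → ‖mu‖ ≤ R →
      (∀ (l : H) (k : Vec m), a * (‖l‖ ^ 2 + ‖k‖ ^ 2) ≤ P.Q x l k) → ‖P.bDeriv ψ x‖ ≤ β →
      ψ.toFun 0 / 2 ≤ P.b ψ x → φ.real (‖P.F x‖ ^ 2) ≤ Cφ * ‖P.F x‖ ^ 2 → ψ.toFun 0 ≤ c →
        DifferentiableAt ℝ (P.augLagReal φ ψ c) (mk3 x lam mu) ∧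
        √a * (c * φ.derivZero * ‖P.F x‖ + c / ψ.toFun 0 * ‖P.q ψ x mu c‖) ≤
          C * (‖gradient (P.augLagReal φ ψ c) (mk3 x lam mu)‖ + ‖P.F x‖ + ‖P.q ψ x mu c‖
            + c * ‖P.F x‖ ^ 2 + c * ‖P.q ψ x mu c‖ ^ 2) := by
  have hψ := ψ.pos
  have hsa : 0 < √a := Real.sqrt_pos.2 ha
  set ψ0 := ψ.toFun 0
  -- `Pi` bounds `1 / p`. With `S` as below, `Ks * S` bounds the residuals and `K2 * S` bounds `w`,
  -- while `C1` is the constant of `abs_eta_deriv_le`.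
  set Pi := 2 * (1 + R ^ 2) / ψ0 with hPi
  have hPi0 : 0 ≤ Pi := by positivity
  set Ks := (2 + R * Cφ + 2 * R / ψ0) / √a with hKs
  have hKs0 : 0 ≤ Ks := by positivity
  set C1 := (1 + m) * (2 * B * (B + R * B + m * (R * B)) + 2 * B * B * R) with hC1
  have hC10 : 0 ≤ C1 := by positivity
  set K2 := 1 + Pi / ψ0 * β + C1 * Ks with hK2
  have hK20 : 0 ≤ K2 := by positivity
  refine ⟨(B + m * B) * K2 + Ks + m * (Pi * (R + B)), by positivity, ?_⟩
  intro x lam mu c hx hxT h2 hB hlam hmu hQ hbD hb hφx hc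
  have hc0 : 0 < c := hψ.trans_le hc
  have hp : 0 < P.p ψ x mu := p_pos hx.1
  have hpc : P.p ψ x mu ≤ c := (p_le hx.1).trans hc
  obtain ⟨D, hD, hDx, hDl, hDm⟩ :=
    hasFDerivAt_augLagReal (lam := lam) (mu := mu) hφ hx hT hxT h2 hc0
  refine ⟨hD.differentiableAt, ?_⟩
  have hG : ‖gradient (P.augLagReal φ ψ c) (mk3 x lam mu)‖ = ‖D‖ := by
    rw [gradient, LinearIsometryEquiv.norm_map, hD.fderiv]
  rw [hG]
  set n := ‖P.F x‖ with hn
  set ρ := ‖P.q ψ x mu c‖ with hρ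
  set u := P.resF x lam mu with hu
  set v := P.resG x lam mu with hv
  set S := ‖D‖ + n + ρ + c * n ^ 2 + c * ρ ^ 2 with hS
  have hn0 : 0 ≤ n := norm_nonneg _
  have hρ0 : 0 ≤ ρ := norm_nonneg _
  have hcn : 0 ≤ c * n ^ 2 := by positivity
  have hcρ : 0 ≤ c * ρ ^ 2 := by positivity
  have hD0 : 0 ≤ ‖D‖ := D.opNorm_nonneg
  have hS0 : 0 ≤ S := by positivity
  have hDS : ‖D‖ ≤ S := by linarith
  have hcpρ : c / P.p ψ x mu * ρ ^ 2 ≤ Pi * S := by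
    have : c / P.p ψ x mu * ρ ^ 2 = (P.p ψ x mu)⁻¹ * (c * ρ ^ 2) := by ring
    rw [this]
    exact mul_le_mul (inv_p_le hb hmu) (by linarith) hcρ hPi0
  have hbinv : (P.b ψ x)⁻¹ ≤ 2 / ψ0 := by
    rw [← inv_div]
    exact inv_anti₀ (by positivity) hb
  -- the multiplier part of the gradient controls the residuals
  have hl : ‖P.F x + (c * φ.real (n ^ 2)) • lam + fderiv ℝ P.F x (P.adjMap x u v)‖ ≤ ‖D‖ := by
    refine norm_le_of_inner_self_le hD0 ?_
    rw [← hDl, ← norm_mk3_mid (X := X) (m := m)]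
    exact (le_abs_self _).trans (D.le_opNorm _)
  have hm : ‖P.q ψ x mu c + (c / P.b ψ x * ρ ^ 2) • mu
      + (P.gradg x (P.adjMap x u v) + P.diagSq x v)‖ ≤ ‖D‖ := by
    refine norm_le_of_inner_self_le hD0 ?_
    rw [← hDm, ← norm_mk3_right (X := X) (H := H)]
    exact (le_abs_self _).trans (D.le_opNorm _)
  have hs : ‖u‖ + ‖v‖ ≤ Ks * S := by
    have e1 : ‖fderiv ℝ P.F x (P.adjMap x u v)‖ ≤ ‖D‖ + (n + c * φ.real (n ^ 2) * ‖lam‖) := by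
      refine (norm_right_le (P.F x + (c * φ.real (n ^ 2)) • lam) _).trans
        (add_le_add ?_ ?_)
      · assumption
      · refine (norm_add_le _ _).trans (le_of_eq ?_)
        rw [norm_smul, Real.norm_of_nonneg (mul_nonneg hc0.le (φ.real_nonneg _))]
    have e2 : ‖P.gradg x (P.adjMap x u v) + P.diagSq x v‖ ≤
        ‖D‖ + (ρ + c / P.b ψ x * ρ ^ 2 * ‖mu‖) := by
      refine (norm_right_le (P.q ψ x mu c + (c / P.b ψ x * ρ ^ 2) • mu) _).trans
        (add_le_add ?_ ?_)
      · assumption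
      · refine (norm_add_le _ _).trans (le_of_eq ?_)
        have : 0 ≤ c / P.b ψ x * ρ ^ 2 :=
          mul_nonneg (div_nonneg hc0.le hx.1.le) (sq_nonneg _)
        rw [norm_smul, Real.norm_of_nonneg this]
    have e3 : c * φ.real (n ^ 2) * ‖lam‖ ≤ R * Cφ * S := by
      calc c * φ.real (n ^ 2) * ‖lam‖ ≤ c * (Cφ * n ^ 2) * R := by gcongr
        _ = R * Cφ * (c * n ^ 2) := by ring
        _ ≤ R * Cφ * S := by gcongr; linarith
    have e4 : c / P.b ψ x * ρ ^ 2 * ‖mu‖ ≤ 2 * R / ψ0 * S := by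
      calc c / P.b ψ x * ρ ^ 2 * ‖mu‖ = (P.b ψ x)⁻¹ * ‖mu‖ * (c * ρ ^ 2) := by ring
        _ ≤ 2 / ψ0 * R * S := by gcongr; linarith
        _ = 2 * R / ψ0 * S := by ring
    have e5 := sqrt_mul_add_le ha hQ u v
    rw [hKs, div_mul_eq_mul_div, le_div_iff₀ hsa, mul_comm]
    linarith
  -- the `x`-part of the gradient
  set z1 : H := (c * (1 + ‖lam‖ ^ 2) * derivWithin φ.real φ.dom (n ^ 2)) • P.F x with hz1
  set z2 : Vec m := (c / P.p ψ x mu) • P.q ψ x mu c with hz2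
  set w := P.gradLagrangian x lam mu + P.adjMap x z1 z2 with hw
  have hwn : ‖w‖ ≤ K2 * S := by
    refine norm_le_of_inner_self_le (by positivity) ?_
    have h1 := hDx w
    have h3 := (le_abs_self _).trans (D.le_opNorm (mk3 w 0 0))
    rw [norm_mk3_left] at h3
    have h4 := hB.abs_eta_deriv_le hlam hmu w
    have h5 : c / (2 * P.p ψ x mu * P.b ψ x) * ρ ^ 2 * P.bDeriv ψ x w ≤
        Pi / ψ0 * β * S * ‖w‖ := by
      have hbw : P.bDeriv ψ x w ≤ β * ‖w‖ :=
        (le_abs_self _).trans (ContinuousLinearMap.le_of_opNorm_le _ hbD w)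
      have hbpos := hx.1
      calc c / (2 * P.p ψ x mu * P.b ψ x) * ρ ^ 2 * P.bDeriv ψ x w
          ≤ c / (2 * P.p ψ x mu * P.b ψ x) * ρ ^ 2 * (β * ‖w‖) := by gcongr
        _ = c / P.p ψ x mu * ρ ^ 2 * (P.b ψ x)⁻¹ * (β * ‖w‖) / 2 := by
            field_simp
        _ ≤ Pi * S * (2 / ψ0) * (β * ‖w‖) / 2 := by gcongr
        _ = Pi / ψ0 * β * S * ‖w‖ := by ring
    have h6 : C1 * (‖u‖ + ‖v‖) * ‖w‖ ≤ C1 * Ks * S * ‖w‖ := by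
      rw [mul_assoc C1 Ks S]
      gcongr
    have h7 : ‖D‖ * ‖w‖ ≤ S * ‖w‖ := by gcongr
    have h8 := neg_abs_le (inner ℝ u
          (fderiv ℝ (fderiv ℝ P.F) x w (P.gradLagrangian x lam mu)
            + fderiv ℝ P.F x (riesz X (P.d2Lag x lam mu w)))
        + ∑ i, v i *
          (fderiv ℝ (fderiv ℝ (P.g i)) x w (P.gradLagrangian x lam mu)
            + fderiv ℝ (P.g i) x (riesz X (P.d2Lag x lam mu w))
            + 2 * P.g i x * fderiv ℝ (P.g i) x w * mu i))
    have h9 : K2 * S * ‖w‖ = S * ‖w‖ + Pi / ψ0 * β * S * ‖w‖ + C1 * Ks * S * ‖w‖ := by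
      rw [hK2]; ring
    linarith
  have hz : √a * (‖z1‖ + ‖z2‖) ≤ ((B + m * B) * K2 + Ks + m * (Pi * (R + B))) * S := by
    refine (sqrt_mul_add_le ha hQ z1 z2).trans ?_
    -- Since `adjMap z1 z2 = w - ∇_x L`, the residuals reappear. Writing `diagSq z2` as `diagSq (mu
    -- + z2) - diagSq mu` completes `v` and leaves the complementarity term.
    have eF : fderiv ℝ P.F x (P.adjMap x z1 z2) = fderiv ℝ P.F x w - u := by
      rw [hw, map_add, hu, resF]
      abel
    have eG : P.gradg x (P.adjMap x z1 z2) + P.diagSq x z2 =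
        P.gradg x w - v + P.diagSq x (mu + z2) := by
      rw [hw, gradg_add, diagSq_add, hv, resG]
      abel
    rw [eF, eG]
    have e1 := norm_sub_le (fderiv ℝ P.F x w) u
    have e2 := (norm_add_le (P.gradg x w - v) (P.diagSq x (mu + z2))).trans
      (add_le_add_left (norm_sub_le (P.gradg x w) v) _)
    have e3 : ‖fderiv ℝ P.F x w‖ ≤ B * (K2 * S) :=
      (hB.norm_fderiv_F_apply_le w).trans (by gcongr)
    have e4 : ‖P.gradg x w‖ ≤ m * (B * (K2 * S)) := (hB.norm_gradg_le w).trans (by gcongr)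
    have e5 : ‖P.diagSq x (mu + z2)‖ ≤ m * (Pi * S * (R + B)) :=
      (hB.norm_diagSq_le hmu hp hpc).trans (by gcongr)
    linarith
  refine le_trans ?_ hz
  gcongr
  -- From below, `z1` is controlled by monotonicity of `φ'`, and `z2` by `p ≤ ψ 0`.
  · have hd := hφ.derivZero_le (toFun_nnnorm_sq_lt_top_iff.1 hx.2)
    have hd0 := hφ0.trans_le hd
    rw [hz1, norm_smul, Real.norm_of_nonneg (by positivity)]
    gcongr
    exact le_mul_of_one_le_right hc0.le (by linarith [sq_nonneg ‖lam‖])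
  · rw [hz2, norm_smul, Real.norm_of_nonneg (by positivity)]
    gcongr
    exact p_le hx.1

end Problem

/-! ### Sublevel sets and the choice of the penalty threshold -/

namespace Problem

variable {X H : Type*} [NormedAddCommGroup X] [InnerProductSpace ℝ X] [CompleteSpace X]
  [NormedAddCommGroup H] [InnerProductSpace ℝ H] [CompleteSpace H] {m : ℕ}
  {P : Problem X H m} {φ : PenaltyFunction} {ψ : WeightFunction m} {x : X} {lam : H}
  {mu : Vec m} {c a B R γ : ℝ}

theorem norm_vmax_gvec_le : ‖vmax (P.gvec x) 0‖ ≤ ‖P.q ψ x mu c‖ := by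
  refine norm_le_norm_of_abs_le fun i => ?_
  have h : P.g i x ≤ P.q ψ x mu c i := by
    rw [q_apply]
    exact le_max_left _ _
  change |max (P.g i x) 0| ≤ _
  rw [abs_of_nonneg (le_max_right _ _)]
  exact max_le (h.trans (le_abs_self _)) (abs_nonneg _)

/-- The denominator `1 + |μ|²` of `p` gives `p |μ|² ≤ b ≤ ψ 0`, so the loss in `neg_le_ineqTerm` is
at most `ψ 0 / c` uniformly in `μ`. -/
theorem le_sum_ineqTerm (hc : 0 < c) (hb : 0 < P.b ψ x) :
    c / (4 * ψ.toFun 0) * ‖P.q ψ x mu c‖ ^ 2 - ψ.toFun 0 / c ≤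
      ∑ i, ineqTerm c (P.g i x) (P.p ψ x mu) (mu i) := by
  have hp : 0 < P.p ψ x mu := p_pos hb
  have h1 : c / (4 * ψ.toFun 0) * ‖P.q ψ x mu c‖ ^ 2 ≤
      c / (4 * P.p ψ x mu) * ‖P.q ψ x mu c‖ ^ 2 := by
    gcongr
    exact p_le hb
  have h2 : P.p ψ x mu * ‖mu‖ ^ 2 / c ≤ ψ.toFun 0 / c := by
    gcongr
    refine le_trans ?_ (P.b_le ψ x)
    rw [p, div_mul_eq_mul_div, div_le_iff₀ (by positivity)]
    nlinarith
  have h3 : c / (4 * P.p ψ x mu) * ‖P.q ψ x mu c‖ ^ 2 - P.p ψ x mu * ‖mu‖ ^ 2 / c ≤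
      ∑ i, ineqTerm c (P.g i x) (P.p ψ x mu) (mu i) := by
    rw [EuclideanSpace.real_norm_sq_eq, EuclideanSpace.real_norm_sq_eq, Finset.mul_sum,
      Finset.mul_sum, Finset.sum_div, ← Finset.sum_sub_distrib]
    refine Finset.sum_le_sum fun i _ => ?_
    rw [q_apply]
    exact neg_le_ineqTerm hc hp _ _
  linarith

/-- On a sublevel set the augmented Lagrangian dominates a quadratic penalty function, uniformly
in the multipliers. -/
theorem le_of_mem_sublevel (hφ : φ.IsC1) (hφ0 : 0 < φ.derivZero) (hc : 0 < c)
    (h : (x, lam, mu) ∈ P.sublevel φ ψ c γ) :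
    x ∈ P.Omega φ ψ ∧ P.f x + c * φ.derivZero / 2 * ‖P.F x‖ ^ 2
      + c / (4 * ψ.toFun 0) * ‖P.q ψ x mu c‖ ^ 2 + P.eta x lam mu ≤
        γ + (ψ.toFun 0 + 1 / φ.derivZero) / c := by
  have hx : x ∈ P.Omega φ ψ := by
    by_contra hx
    have h' : P.augLag φ ψ x lam mu c ≤ (γ : EReal) := h
    rw [augLag, if_neg hx] at h'
    exact EReal.coe_ne_top γ (top_le_iff.1 h')
  refine ⟨hx, ?_⟩
  have h' : P.augLag φ ψ x lam mu c ≤ (γ : EReal) := h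
  rw [augLag_of_mem hx, EReal.coe_le_coe_iff] at h'
  have h1 := le_sum_ineqTerm (mu := mu) hc hx.1
  set κ := φ.derivZero
  have h2 : c / 2 * (1 + ‖lam‖ ^ 2) * (κ * ‖P.F x‖ ^ 2) ≤
      c / 2 * (1 + ‖lam‖ ^ 2) * φ.real (‖P.F x‖ ^ 2) := by
    have := hφ.derivZero_mul_le (toFun_nnnorm_sq_lt_top_iff.1 hx.2)
    gcongr
  have h3 : -(‖lam‖ * ‖P.F x‖) ≤ inner ℝ lam (P.F x) :=
    (abs_le.1 (abs_real_inner_le_norm _ _)).1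
  -- The factor `1 + ‖λ‖²` in the penalty pays for `⟨λ, F⟩`: a quadratic in `‖λ‖‖F‖` absorbs it at
  -- cost `O(1 / c)`.
  have h4 : 0 ≤ c * κ / 2 * (‖lam‖ * ‖P.F x‖) ^ 2 - ‖lam‖ * ‖P.F x‖ + 1 / κ / c := by
    have e : c * κ / 2 * (‖lam‖ * ‖P.F x‖) ^ 2 - ‖lam‖ * ‖P.F x‖ + 1 / κ / c =
        1 / (2 * c * κ) * ((c * κ * (‖lam‖ * ‖P.F x‖) - 1) ^ 2 + 1) := by
      field_simp
      ring
    rw [e]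
    positivity
  have h5 : (ψ.toFun 0 + 1 / κ) / c = ψ.toFun 0 / c + 1 / κ / c := by ring
  have h6 : c / 2 * (1 + ‖lam‖ ^ 2) * (κ * ‖P.F x‖ ^ 2) =
      c * κ / 2 * ‖P.F x‖ ^ 2 + c * κ / 2 * (‖lam‖ * ‖P.F x‖) ^ 2 := by ring
  linarith

theorem eta_nonneg : 0 ≤ P.eta x lam mu := by
  rw [eta]
  positivity

/-- Near feasibility on sublevel sets for large penalty parameters. -/
theorem exists_infeas_le (P : Problem X H m) (ψ : WeightFunction m) (hφ : φ.IsC1)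
    (hφ0 : 0 < φ.derivZero) (B γ : ℝ) {δ : ℝ} (hδ : 0 < δ) :
    ∃ cstar > 0, ∀ c ≥ cstar, ∀ x lam mu, (x, lam, mu) ∈ P.sublevel φ ψ c γ → ‖P.f x‖ ≤ B →
      ‖P.F x‖ ≤ δ ∧ ‖P.q ψ x mu c‖ ≤ δ := by
  set κ := φ.derivZero
  have hψ := ψ.pos
  set ψ0 := ψ.toFun 0
  set E := |γ| + |B| + ψ0 + 1 / κ with hE
  have hE0 : 0 < E := by positivity
  -- `E` bounds both penalty terms, whence `c ‖F‖² ≤ (2 / κ) E` and `c ‖q‖² ≤ 4 ψ0 E`. The summand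
  -- `1` gives `c ≥ 1`, so the division by `c` in the error can be dropped.
  refine ⟨1 + (2 / κ + 4 * ψ0) * E / δ ^ 2, by positivity, fun c hc x lam mu hz hf => ?_⟩
  have hc1 : 1 ≤ c := by
    linarith [show 0 ≤ (2 / κ + 4 * ψ0) * E / δ ^ 2 by positivity]
  have hc0 : 0 < c := by linarith
  have hcδ : (2 / κ + 4 * ψ0) * E ≤ c * δ ^ 2 := by
    rw [← div_le_iff₀ (by positivity)]
    linarith
  obtain ⟨-, h⟩ := le_of_mem_sublevel hφ hφ0 hc0 hz
  have h1 : (ψ0 + 1 / κ) / c ≤ ψ0 + 1 / κ := div_le_self (by positivity) hc1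
  have h2 : -B ≤ P.f x := (abs_le.1 hf).1
  have h3 := eta_nonneg (P := P) (x := x) (lam := lam) (mu := mu)
  have h4 : 0 ≤ c * κ / 2 * ‖P.F x‖ ^ 2 := by positivity
  have h5 : 0 ≤ c / (4 * ψ0) * ‖P.q ψ x mu c‖ ^ 2 := by positivity
  have h6 := le_abs_self γ
  have h7 := le_abs_self B
  constructor
  · refine (pow_le_pow_iff_left₀ (norm_nonneg _) hδ.le two_ne_zero).1 ?_
    have e1 : c * κ / 2 * ‖P.F x‖ ^ 2 ≤ E := by linarith
    have e2 : c * ‖P.F x‖ ^ 2 ≤ 2 / κ * E := by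
      calc c * ‖P.F x‖ ^ 2 = 2 / κ * (c * κ / 2 * ‖P.F x‖ ^ 2) := by field_simp
        _ ≤ 2 / κ * E := by gcongr
    refine le_of_mul_le_mul_left ?_ hc0
    linarith [mul_pos hψ hE0]
  · refine (pow_le_pow_iff_left₀ (norm_nonneg _) hδ.le two_ne_zero).1 ?_
    have e1 : c / (4 * ψ0) * ‖P.q ψ x mu c‖ ^ 2 ≤ E := by linarith
    have e2 : c * ‖P.q ψ x mu c‖ ^ 2 ≤ 4 * ψ0 * E := by
      calc c * ‖P.q ψ x mu c‖ ^ 2 = 4 * ψ0 * (c / (4 * ψ0) * ‖P.q ψ x mu c‖ ^ 2) := by field_simp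
        _ ≤ 4 * ψ0 * E := by gcongr
    refine le_of_mul_le_mul_left ?_ hc0
    have : 0 < 2 / κ * E := by positivity
    linarith

/-- Lower estimate of the gradient for bounded multipliers. -/
theorem exists_gradEstimate (hf : ContDiffOn ℝ 2 P.f (P.Omega φ ψ))
    (hF : ContDiffOn ℝ 2 P.F (P.Omega φ ψ)) (hg : ∀ i, ContDiffOn ℝ 2 (P.g i) (P.Omega φ ψ))
    (hφ : φ.IsC1) (hφ0 : 0 < φ.derivZero) {V : Set X} (hV : P.Admissible φ ψ V) (K γ : ℝ)
    (hR : 0 ≤ R) :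
    ∃ cstar > 0, ∀ c ≥ cstar, ∀ x ∈ V, ∀ lam mu, ‖lam‖ ≤ R → ‖mu‖ ≤ R →
      (x, lam, mu) ∈ P.sublevel φ ψ c γ → P.GradEstimate φ ψ K c x lam mu := by
  obtain ⟨B, hB0, hB⟩ := hV.exists_c2BoundAt
  obtain ⟨a, ha, hQ⟩ := hV.2.2.1
  obtain ⟨T, hT0, hT, Cφ, hCφ, hφT⟩ := φ.exists_real_le_mul
  obtain ⟨Cψ, hCψ, hψb⟩ := ψ.exists_norm_fderivWithin_le (m * B)
  obtain ⟨δψ, hδψ, hψh⟩ := ψ.exists_half_le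
  obtain ⟨C, hC0, hC⟩ := exists_gradient_estimate (P := P) (ψ := ψ) hφ hφ0 hT ha hR hB0
    (β := m * (Cψ * B)) (by positivity) hCφ
  have hψ := ψ.pos
  set κ := φ.derivZero
  set ψ0 := ψ.toFun 0
  set τ := √a * min κ (1 / ψ0) with hτ
  have hsa : 0 < √a := Real.sqrt_pos.2 ha
  have hτ0 : 0 < τ := mul_pos hsa (lt_min hφ0 (by positivity))
  -- The three bounds serve, in order, `b ≥ ψ 0 / 2`, the strict inequality `‖F‖² < T`, and `C δ ≤ τ
  -- / 4`, which absorbs the quadratic terms.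
  set δ := min (min δψ (√T / 2)) (τ / (4 * (C + 1))) with hδ
  have hsT : 0 < √T := Real.sqrt_pos.2 hT0
  have hδ0 : 0 < δ := lt_min (lt_min hδψ (by positivity)) (by positivity)
  obtain ⟨c1, hc10, hc1⟩ := exists_infeas_le P ψ hφ hφ0 B γ hδ0
  -- `4 C / τ` lets the linear terms cost another quarter of `τ c (n + ρ)`; `2 K (C + 1) / τ` makes
  -- the remaining half exceed `K (C + 1) (n + ρ)`. The factor is `C + 1` because `C` may vanish.
  refine ⟨max c1 (max ψ0 (max (4 * C / τ) (2 * K * (C + 1) / τ))), lt_max_of_lt_left hc10, ?_⟩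
  intro c hc x hxV lam mu hlam hmu hz
  obtain ⟨hcc1, hc'⟩ := max_le_iff.1 hc
  obtain ⟨hcψ, hc''⟩ := max_le_iff.1 hc'
  obtain ⟨hcC, hcK⟩ := max_le_iff.1 hc''
  rw [div_le_iff₀ hτ0] at hcC hcK
  have hc0 : 0 < c := hc10.trans_le hcc1
  have hx : x ∈ P.Omega φ ψ := hV.1 hxV
  have hBx := hB x hxV
  obtain ⟨hn, hρ⟩ := hc1 c hcc1 x lam mu hz hBx.f_zero
  have hnT : ‖P.F x‖ ^ 2 < T := by
    have : ‖P.F x‖ < √T := by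
      linarith [hn.trans ((min_le_left _ _).trans (min_le_right _ _))]
    calc ‖P.F x‖ ^ 2 < √T ^ 2 := pow_lt_pow_left₀ this (norm_nonneg _) two_ne_zero
      _ = T := Real.sq_sqrt hT0.le
  have hvm : ‖vmax (P.gvec x) 0‖ ≤ m * B :=
    (norm_vmax_zero_le _).trans (norm_le_card_mul fun i => hBx.g_zero i)
  obtain ⟨hdiff, hmain⟩ := hC x lam mu c hx hnT
    (twiceDiffAt_of_mem_nhds hf hF hg (Omega_mem_nhds hx hT hnT)) hBx hlam hmu (hQ x hxV)
    (P.norm_bDeriv_le ψ hBx.g_one (hψb _ (vmax_zero_mem_orthant _) hvm))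
    (hψh _ (vmax_zero_mem_orthant _) (norm_vmax_gvec_le.trans
      (hρ.trans ((min_le_left _ _).trans (min_le_left _ _)))))
    (hφT _ (sq_nonneg _) hnT.le) hcψ
  refine ⟨hdiff, ?_⟩
  rw [infeas]
  set n := ‖P.F x‖
  set ρ := ‖P.q ψ x mu c‖
  set G := ‖gradient (P.augLagReal φ ψ c) (mk3 x lam mu)‖
  have hn0 : 0 ≤ n := norm_nonneg _
  have hρ0 : 0 ≤ ρ := norm_nonneg _
  have hG0 : 0 ≤ G := norm_nonneg _
  have hCδ : C * δ ≤ τ / 4 := by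
    have h1 : δ ≤ τ / (4 * (C + 1)) := min_le_right _ _
    rw [le_div_iff₀ (by positivity)] at h1
    nlinarith
  have h1 : τ * (c * (n + ρ)) ≤ √a * (c * κ * n + c / ψ0 * ρ) := by
    rw [hτ, mul_assoc]
    refine mul_le_mul_of_nonneg_left ?_ hsa.le
    have e1 := mul_le_mul_of_nonneg_right (min_le_left κ (1 / ψ0)) (mul_nonneg hc0.le hn0)
    have e2 := mul_le_mul_of_nonneg_right (min_le_right κ (1 / ψ0)) (mul_nonneg hc0.le hρ0)
    have e3 : c / ψ0 * ρ = 1 / ψ0 * (c * ρ) := by ring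
    linarith
  have h2 : C * (c * n ^ 2 + c * ρ ^ 2) ≤ τ / 4 * (c * (n + ρ)) := by
    calc C * (c * n ^ 2 + c * ρ ^ 2) ≤ C * (c * (δ * n) + c * (δ * ρ)) := by
          rw [sq, sq]
          gcongr
      _ = C * δ * (c * (n + ρ)) := by ring
      _ ≤ τ / 4 * (c * (n + ρ)) := by gcongr
  have h3 : C * (n + ρ) ≤ τ / 4 * (c * (n + ρ)) := by
    calc C * (n + ρ) ≤ c * τ / 4 * (n + ρ) := by
          gcongr
          linarith
      _ = τ / 4 * (c * (n + ρ)) := by ring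
  have h4 : 2 * K * (C + 1) * (n + ρ) ≤ c * τ * (n + ρ) := by gcongr
  refine le_of_mul_le_mul_left (a := C + 1) ?_ (by positivity)
  linarith

/-- A bound on `η` bounds the multipliers. -/
theorem norm_add_le_of_eta_le (hB : P.C2BoundAt B x) (ha : 0 < a)
    (hQ : ∀ (l : H) (k : Vec m), a * (‖l‖ ^ 2 + ‖k‖ ^ 2) ≤ P.Q x l k) {E : ℝ}
    (hE : P.eta x lam mu ≤ E) :
    ‖lam‖ + ‖mu‖ ≤ (1 + E + (B * B + m * (B * B))) / √a := by
  have h0 := hB.nonneg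
  rw [le_div_iff₀ (Real.sqrt_pos.2 ha), mul_comm]
  refine (sqrt_mul_add_le ha hQ lam mu).trans ?_
  rw [eta] at hE
  set u := fderiv ℝ P.F x (P.gradLagrangian x lam mu) with hu
  set v := P.gradg x (P.gradLagrangian x lam mu) + P.diagSq x mu with hv
  -- Removing the `∇f` part from the residuals leaves the pair whose norm `Q(x)[λ, μ]` measures.
  have eF : fderiv ℝ P.F x (P.adjMap x lam mu) = u - fderiv ℝ P.F x (gradient P.f x) := by
    rw [hu, gradLagrangian_eq, map_add]
    abel
  have eG : P.gradg x (P.adjMap x lam mu) + P.diagSq x mu =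
      v - P.gradg x (gradient P.f x) := by
    rw [hv, gradLagrangian_eq, gradg_add]
    abel
  have hgr : ‖gradient P.f x‖ ≤ B := by
    rw [gradient, LinearIsometryEquiv.norm_map]
    exact hB.f_one
  have e1 : ‖fderiv ℝ P.F x (gradient P.f x)‖ ≤ B * B :=
    (hB.norm_fderiv_F_apply_le _).trans (by gcongr)
  have e2 : ‖P.gradg x (gradient P.f x)‖ ≤ m * (B * B) :=
    (hB.norm_gradg_le _).trans (by gcongr)
  rw [eF, eG]
  have e3 := norm_sub_le u (fderiv ℝ P.F x (gradient P.f x))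
  have e4 := norm_sub_le v (P.gradg x (gradient P.f x))
  -- `t ≤ (t² + 1) / 2` for both residuals gives `‖u‖ + ‖v‖ ≤ 1 + η`.
  nlinarith [sq_nonneg (‖u‖ - 1), sq_nonneg (‖v‖ - 1)]

/-- For large penalty parameters, sublevel sets of the augmented Lagrangian lie over sublevel
sets of the quadratic penalty function. -/
theorem exists_sublevel_subset (P : Problem X H m) (ψ : WeightFunction m) (hφ : φ.IsC1)
    (hφ0 : 0 < φ.derivZero) (r γ : ℝ) {ε : ℝ} (hε : 0 < ε) :
    ∃ cstar > 0, ∀ c ≥ cstar, ∀ x lam mu, (x, lam, mu) ∈ P.sublevel φ ψ c γ →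
      x ∈ P.penaltySublevel φ ψ r (γ + ε) ∧ P.f x + P.eta x lam mu ≤ γ + ε := by
  set κ := φ.derivZero
  have hψ := ψ.pos
  set ψ0 := ψ.toFun 0
  -- The first threshold makes the `O(1 / c)` error at most `ε`; the other two make the coefficients
  -- of `‖F‖²` and `‖q‖²` at least `r`.
  refine ⟨max ((ψ0 + 1 / κ) / ε) (max (2 * r / κ) (4 * ψ0 * r)),
    lt_max_of_lt_left (by positivity), fun c hc x lam mu hz => ?_⟩
  obtain ⟨hc1, hc'⟩ := max_le_iff.1 hc
  obtain ⟨hc2, hc3⟩ := max_le_iff.1 hc'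
  have hc0 : 0 < c := lt_of_lt_of_le (by positivity) hc1
  obtain ⟨hx, h⟩ := le_of_mem_sublevel hφ hφ0 hc0 hz
  have h1 : (ψ0 + 1 / κ) / c ≤ ε := by
    rw [div_le_iff₀ hε] at hc1
    rw [div_le_iff₀ hc0]
    linarith
  have h2 : r * ‖P.F x‖ ^ 2 ≤ c * κ / 2 * ‖P.F x‖ ^ 2 := by
    rw [div_le_iff₀ hφ0] at hc2
    gcongr
    linarith
  have h3 : r * ‖vmax (P.gvec x) 0‖ ^ 2 ≤ c / (4 * ψ0) * ‖P.q ψ x mu c‖ ^ 2 := by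
    have : r ≤ c / (4 * ψ0) := by
      rw [le_div_iff₀ (by positivity)]
      linarith
    calc r * ‖vmax (P.gvec x) 0‖ ^ 2 ≤ c / (4 * ψ0) * ‖vmax (P.gvec x) 0‖ ^ 2 := by gcongr
      _ ≤ c / (4 * ψ0) * ‖P.q ψ x mu c‖ ^ 2 := by
        gcongr
        exact norm_vmax_gvec_le
  have h4 := eta_nonneg (P := P) (x := x) (lam := lam) (mu := mu)
  have h5 : 0 ≤ c * κ / 2 * ‖P.F x‖ ^ 2 := by positivity
  have h6 : 0 ≤ c / (4 * ψ0) * ‖P.q ψ x mu c‖ ^ 2 := by positivity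
  refine ⟨⟨hx, ?_⟩, by linarith⟩
  rw [mul_add]
  linarith

end Problem

end ExactAL

end

theorem mainTheorem1 {X H : Type*}
    [NormedAddCommGroup X] [InnerProductSpace ℝ X] [CompleteSpace X]
    [NormedAddCommGroup H] [InnerProductSpace ℝ H] [CompleteSpace H] {m : ℕ}
    (P : ExactAL.Problem X H m) (φ : ExactAL.PenaltyFunction) (ψ : ExactAL.WeightFunction m)
    (hf : ContDiffOn ℝ 2 P.f (P.Omega φ ψ))
    (hF : ContDiffOn ℝ 2 P.F (P.Omega φ ψ))
    (hg : ∀ i, ContDiffOn ℝ 2 (P.g i) (P.Omega φ ψ))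
    (hφ : φ.IsC1) (hφ0 : 0 < φ.derivZero) :
    (∀ V : Set X, P.Admissible φ ψ V →
      ∀ K > 0, ∀ γ : ℝ, ∀ Λ : Set (H × ExactAL.Vec m), Bornology.IsBounded Λ →
        ∃ cstar > 0, ∀ c ≥ cstar, ∀ (x : X) (lam : H) (mu : ExactAL.Vec m),
          (x, lam, mu) ∈ (V ×ˢ Λ) ∩ P.sublevel φ ψ c γ →
            P.GradEstimate φ ψ K c x lam mu) ∧
    (∀ r > 0, ∀ ε > 0, ∀ γ : ℝ, P.Admissible φ ψ (P.penaltySublevel φ ψ r (γ + ε)) →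
      ∀ K > 0, ∃ cstar > 0, ∀ c ≥ cstar, ∀ (x : X) (lam : H) (mu : ExactAL.Vec m),
        (x, lam, mu) ∈ P.sublevel φ ψ c γ →
          P.GradEstimate φ ψ K c x lam mu) := by
  refine ⟨fun V hV K _ γ Λ hΛ => ?_, fun r _ ε hε γ hV K _ => ?_⟩
  · obtain ⟨R, hR0, hR⟩ := hΛ.exists_pos_norm_le
    obtain ⟨cstar, h0, h⟩ :=
      ExactAL.Problem.exists_gradEstimate hf hF hg hφ hφ0 hV K γ hR0.le
    refine ⟨cstar, h0, fun c hc x lam mu hz => ?_⟩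
    have hn := hR _ hz.1.2
    exact h c hc x hz.1.1 lam mu ((norm_fst_le (lam, mu)).trans hn)
      ((norm_snd_le (lam, mu)).trans hn) hz.2
  · obtain ⟨B, -, hB⟩ := hV.exists_c2BoundAt
    obtain ⟨a, ha, hQ⟩ := hV.2.2.1
    obtain ⟨c1, h1, hsub⟩ := ExactAL.Problem.exists_sublevel_subset P ψ hφ hφ0 r γ hε
    -- The multiplier bound for `η ≤ γ + ε - f ≤ γ + ε + B`; the absolute value only secures `R ≥
    -- 0`.
    set R := |(1 + (γ + ε + B) + (B * B + m * (B * B))) / √a|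
    obtain ⟨c2, h2, h⟩ :=
      ExactAL.Problem.exists_gradEstimate hf hF hg hφ hφ0 hV K γ (R := R) (abs_nonneg _)
    refine ⟨max c1 c2, lt_max_of_lt_left h1, fun c hc x lam mu hz => ?_⟩
    obtain ⟨hx, heta⟩ := hsub c ((le_max_left _ _).trans hc) x lam mu hz
    have hf0 : -B ≤ P.f x := (abs_le.1 (hB x hx).f_zero).1
    have hn := (ExactAL.Problem.norm_add_le_of_eta_le (lam := lam) (mu := mu) (E := γ + ε + B)
      (hB x hx) ha (hQ x hx) (by linarith)).trans (le_abs_self _)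
    exact h c ((le_max_right _ _).trans hc) x hx lam mu
      (by linarith [norm_nonneg mu]) (by linarith [norm_nonneg lam]) hz
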